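/- Let $N\in\mathbb{N}$ and let $A,B\in M_N(\mathbb{Z})$ satisfy: $A_{i,j}\ge 0$ for all $i,j$; $A$ has no identically zero row; and $B_{i,j}=0$ whenever $A_{i,j}=0$. Let $E$ be the directed graph with vertex set $\{1,\dots,N\}$ and edges $e_{i,j,n}$, $0\le n<A_{i,j}$, with source $s(e_{i,j,n})=i$ and range $r(e_{i,j,n})=j$. For $m\in\mathbb{Z}$ and an edge $e_{i,j,n}$ write $mB_{i,j}+n=kA_{i,j}+l$ with $k,l\in\mathbb{Z}$ and $0\le l<A_{i,j}$, and set $\kappa_m(e_{i,j,n})=e_{i,j,l}$ and $\varphi(m,e_{i,j,n})=k$. The pair $(A,B)$ is called pseudo free if $\kappa_m(e)=e$ and $\varphi(m,e)=0$, for $m\in\mathbb{Z}$ and an edge $e$, imply $m=0$. Let $E^*$ be the set of finite paths (including the vertices as paths of length zero) and $E^\infty$ the space of infinite paths $x=x_1x_2\cdots$, $r(x_i)=s(x_{i+1})$, with the topology induced by the product of the discrete topologies. For $\beta\in E^*$ let $Z(\beta)=\{\beta y: y\in E^\infty,\ s(y)=r(\beta)\}$. The action extends to $E^\infty$ by $\kappa_m(\gamma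 y)=\kappa_m(\gamma)\kappa_{\varphi(m,\gamma)}(y)$ for edges $\gamma$. The Katsura--Exel--Pardo groupoid $\mathcal{G}_{A,B}$ is the set of classes $[\alpha,m,\beta;x]$ of quadruples with $\alpha,\beta\in E^*$, $r(\alpha)=r(\beta)$, $m\in\mathbb{Z}$, $x\in Z(\beta)$, under the equivalence relation generated by $(\alpha,m,\beta;x)\sim(\alpha\kappa_m(\gamma),\varphi(m,\gamma),\beta\gamma;x)$ for $x=\beta\gamma y$ with $\gamma$ an edge. Its units are the elements $[v,0,v;x]$ with $v=s(x)$, identified with $x\in E^\infty$; source and range are $s([\alpha,m,\beta;\beta y])=\beta y$ and $r([\alpha,m,\beta;\beta y])=\alpha\kappa_m(y)$; the product is $[\alpha,m',\beta;\beta\kappa_m(y)]\cdot[\beta,m,\gamma;\gamma y]=[\alpha,m'+m,\gamma;\gamma y]$ and the inverse is $[\alpha,m,\beta;\beta y]^{-1}=[\beta,-m,\alpha;\alpha\kappa_m(y)]$. Its topology is generated by the sets $\{[\alpha,m,\beta;x]:x\in U\}$ with $U\subseteq Z(\beta)$ compact and open. Two étale groupoids $\mathcal{G},\mathcal{H}$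 with totally disconnected unit spaces are called Kakutani equivalent if there are clopen sets $S\subseteq\mathcal{G}^{(0)}$ and $T\subseteq\mathcal{H}^{(0)}$, each meeting every orbit, such that the restrictions $\{g\in\mathcal{G}: s(g),r(g)\in S\}$ and $\{h\in\mathcal{H}: s(h),r(h)\in T\}$ are isomorphic as topological groupoids. Let $N,N'\in\mathbb{N}$, and let $A,B\in M_N(\mathbb{Z})$ and $A',B'\in M_{N'}(\mathbb{Z})$ be pseudo free pairs, each satisfying the three conditions at the beginning. If $\mathcal{G}_{A,B}$ and $\mathcal{G}_{A',B'}$ are Kakutani equivalent, then $\ker(I-A)\cong\ker(I-A')$ and $\ker(I-B)\cong\ker(I-B')$ as abelian groups, where the kernels are those of the endomorphisms of $\mathbb{Z}^N$ and $\mathbb{Z}^{N'}$ given by the matrices. -/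

import Mathlib

/-- A groupoid, presented by its set of arrows `G`: units are particular arrows, the product
`g * h` is defined exactly when the source of `g` is the range of `h`. -/
class ArrowGroupoid (G : Type*) where
  src : G → G
  rng : G → G
  inv : G → G
  mul : ∀ g h : G, src g = rng h → G
  src_src : ∀ g, src (src g) = src g
  rng_src : ∀ g, rng (src g) = src g
  src_rng : ∀ g, src (rng g) = rng g
  rng_rng : ∀ g, rng (rng g) = rng g
  src_mul : ∀ g h (c : src g = rng h), src (mul g h c) = src h
  rng_mul : ∀ g h (c : src g = rng h), rng (mul g h c) = rng g
  mul_assoc : ∀ g h k (c : src g = rng h) (d : src h = rng k),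
    mul (mul g h c) k ((src_mul g h c).trans d) = mul g (mul h k d) (c.trans (rng_mul h k d).symm)
  mul_src : ∀ g, mul g (src g) (rng_src g).symm = g
  rng_mul_self : ∀ g, mul (rng g) g (src_rng g) = g
  src_inv : ∀ g, src (inv g) = rng g
  rng_inv : ∀ g, rng (inv g) = src g
  mul_inv : ∀ g, mul g (inv g) (rng_inv g).symm = rng g
  inv_mul : ∀ g, mul (inv g) g (src_inv g) = src g

namespace ArrowGroupoid

/-- The unit space: the arrows that are their own source. As a subtype it carries the relative
topology whenever `G` has a topology. -/
def UnitSpace (G : Type*) [ArrowGroupoid G] : Type _ := {u : G // src u = u}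

instance (G : Type*) [ArrowGroupoid G] [TopologicalSpace G] : TopologicalSpace (UnitSpace G) :=
  inferInstanceAs (TopologicalSpace {u : G // src u = u})

variable {G : Type*} [ArrowGroupoid G]

/-- The source map with values in the unit space. -/
def source (g : G) : UnitSpace G := ⟨src g, src_src g⟩

/-- The range map with values in the unit space. -/
def range (g : G) : UnitSpace G := ⟨rng g, src_rng g⟩

/-- A set of units is full if it meets every orbit. -/
def IsFull (S : Set (UnitSpace G)) : Prop :=
  ∀ x : UnitSpace G, ∃ g : G, source g = x ∧ range g ∈ S

/-- The restriction of `G` to a set `S` of units: all arrows with source and range in `S`.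
As a subtype it carries the relative topology whenever `G` has a topology. -/
def Restriction (S : Set (UnitSpace G)) : Type _ := {g : G // source g ∈ S ∧ range g ∈ S}

instance (S : Set (UnitSpace G)) [TopologicalSpace G] : TopologicalSpace (Restriction S) :=
  inferInstanceAs (TopologicalSpace {g : G // source g ∈ S ∧ range g ∈ S})

theorem source_eq_of {g h : G} (c : src g = src h) : source g = source h := Subtype.ext c

theorem range_eq_of {g h : G} (c : rng g = rng h) : range g = range h := Subtype.ext c

theorem source_eq_range_of {g h : G} (c : src g = rng h) : source g = range h := Subtype.ext c

instance (S : Set (UnitSpace G)) : ArrowGroupoid (Restriction S) where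
  src g := ⟨src g.1, by rw [source_eq_of (src_src g.1)]; exact g.2.1,
    by rw [← source_eq_range_of (rng_src g.1).symm]; exact g.2.1⟩
  rng g := ⟨rng g.1, by rw [source_eq_range_of (h := g.1) (src_rng g.1)]; exact g.2.2,
    by rw [range_eq_of (rng_rng g.1)]; exact g.2.2⟩
  inv g := ⟨inv g.1, by rw [source_eq_range_of (src_inv g.1)]; exact g.2.2,
    by rw [← source_eq_range_of (rng_inv g.1).symm]; exact g.2.1⟩
  mul g h c := ⟨mul g.1 h.1 (congrArg Subtype.val c),
    by rw [source_eq_of (src_mul g.1 h.1 _)]; exact h.2.1,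
    by rw [range_eq_of (rng_mul g.1 h.1 _)]; exact g.2.2⟩
  src_src g := Subtype.ext (src_src g.1)
  rng_src g := Subtype.ext (rng_src g.1)
  src_rng g := Subtype.ext (src_rng g.1)
  rng_rng g := Subtype.ext (rng_rng g.1)
  src_mul g h c := Subtype.ext (src_mul g.1 h.1 _)
  rng_mul g h c := Subtype.ext (rng_mul g.1 h.1 _)
  mul_assoc g h k c d := Subtype.ext (mul_assoc g.1 h.1 k.1 _ _)
  mul_src g := Subtype.ext (mul_src g.1)
  rng_mul_self g := Subtype.ext (rng_mul_self g.1)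
  src_inv g := Subtype.ext (src_inv g.1)
  rng_inv g := Subtype.ext (rng_inv g.1)
  mul_inv g := Subtype.ext (mul_inv g.1)
  inv_mul g := Subtype.ext (inv_mul g.1)

/-- An isomorphism of topological groupoids: a homeomorphism such that two arrows are composable
if and only if their images are, and which carries products to products. -/
structure TopIso (G H : Type*) [ArrowGroupoid G] [ArrowGroupoid H]
    [TopologicalSpace G] [TopologicalSpace H] extends G ≃ₜ H where
  composable_iff : ∀ g h : G, src g = rng h ↔ src (toFun g) = rng (toFun h)
  map_mul : ∀ (g h : G) (c : src g = rng h),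
    toFun (mul g h c) = mul (toFun g) (toFun h) ((composable_iff g h).1 c)

/-- Kakutani equivalence: there are full clopen subsets of the unit spaces such that the
restrictions to them are isomorphic as topological groupoids. -/
def KakutaniEquivalent (G H : Type*) [ArrowGroupoid G] [ArrowGroupoid H]
    [TopologicalSpace G] [TopologicalSpace H] : Prop :=
  ∃ (S : Set (UnitSpace G)) (T : Set (UnitSpace H)), IsClopen S ∧ IsFull S ∧ IsClopen T ∧ IsFull T ∧
    Nonempty (TopIso (Restriction S) (Restriction T))

end ArrowGroupoid

namespace Katsura

/-- The edges `e_{i,j,n}`, `0 ≤ n < A i j`, of the graph with vertex set `Fin N`; the edge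
`e_{i,j,n}` goes from `i` (its source) to `j` (its range). -/
@[ext]
structure Edge {N : ℕ} (A : Matrix (Fin N) (Fin N) ℤ) where
  src : Fin N
  tgt : Fin N
  idx : ℤ
  idx_nonneg : 0 ≤ idx
  idx_lt : idx < A src tgt

variable {N : ℕ} {A : Matrix (Fin N) (Fin N) ℤ} (B : Matrix (Fin N) (Fin N) ℤ)

theorem Edge.pos (e : Edge A) : 0 < A e.src e.tgt := e.idx_nonneg.trans_lt e.idx_lt

/-- The set of edges is discrete. -/
instance : TopologicalSpace (Edge A) := ⊥

/-- `κ_m(e_{i,j,n}) = e_{i,j,l}`, where `m B_{i,j} + n = k A_{i,j} + l` with `0 ≤ l < A_{i,j}`. -/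
def act (m : ℤ) (e : Edge A) : Edge A where
  src := e.src
  tgt := e.tgt
  idx := (m * B e.src e.tgt + e.idx) % A e.src e.tgt
  idx_nonneg := Int.emod_nonneg _ e.pos.ne'
  idx_lt := Int.emod_lt_of_pos _ e.pos

/-- `φ(m, e_{i,j,n}) = k`, where `m B_{i,j} + n = k A_{i,j} + l` with `0 ≤ l < A_{i,j}`. -/
def coc (m : ℤ) (e : Edge A) : ℤ := (m * B e.src e.tgt + e.idx) / A e.src e.tgt

/-- The pair `(A, B)` is pseudo free: `κ_m(e) = e` and `φ(m, e) = 0` force `m = 0`. -/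
def PseudoFree (A B : Matrix (Fin N) (Fin N) ℤ) : Prop :=
  ∀ (m : ℤ) (e : Edge A), act B m e = e → coc B m e = 0 → m = 0

@[simp] theorem act_src (m : ℤ) (e : Edge A) : (act B m e).src = e.src := rfl

@[simp] theorem act_tgt (m : ℤ) (e : Edge A) : (act B m e).tgt = e.tgt := rfl

theorem coc_mul_add (m : ℤ) (e : Edge A) :
    coc B m e * A e.src e.tgt + (act B m e).idx = m * B e.src e.tgt + e.idx :=
  Int.ediv_mul_add_emod _ _

theorem act_coc_eq {m k : ℤ} {e f : Edge A} (hs : f.src = e.src) (ht : f.tgt = e.tgt)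
    (h : m * B e.src e.tgt + e.idx = k * A e.src e.tgt + f.idx) :
    act B m e = f ∧ coc B m e = k := by
  have h0 := f.idx_nonneg
  have h1 := f.idx_lt
  rw [hs, ht] at h1
  have h2 : (m * B e.src e.tgt + e.idx) / A e.src e.tgt = k ∧
      (m * B e.src e.tgt + e.idx) % A e.src e.tgt = f.idx := by
    rw [Int.ediv_emod_unique e.pos]
    refine ⟨?_, h0, h1⟩
    rw [h]; ring
  exact ⟨Edge.ext hs.symm ht.symm h2.2, h2.1⟩

theorem act_coc_add (m n : ℤ) (e : Edge A) :
    act B (m + n) e = act B m (act B n e) ∧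
      coc B (m + n) e = coc B m (act B n e) + coc B n e := by
  refine act_coc_eq B (f := act B m (act B n e)) rfl rfl ?_
  have h1 := coc_mul_add B n e
  have h2 := coc_mul_add B m (act B n e)
  simp only [act_src, act_tgt] at h2
  linarith

theorem act_coc_zero (e : Edge A) : act B 0 e = e ∧ coc B 0 e = 0 := by
  apply act_coc_eq B rfl rfl
  ring

/-- The infinite path space, with the topology induced by the product topology. -/
def InfPath (A : Matrix (Fin N) (Fin N) ℤ) : Type :=
  {x : ℕ → Edge A // ∀ n, (x n).tgt = (x (n + 1)).src}

instance : TopologicalSpace (InfPath A) :=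
  inferInstanceAs (TopologicalSpace {x : ℕ → Edge A // ∀ n, (x n).tgt = (x (n + 1)).src})

namespace InfPath

/-- The source vertex of an infinite path. -/
def start (x : InfPath A) : Fin N := (x.1 0).src

/-- The infinite path without its first edge. -/
def shift (x : InfPath A) : InfPath A := ⟨fun n => x.1 (n + 1), fun n => x.2 (n + 1)⟩

/-- The integer acting on the `n`-th edge when `m` acts on the infinite path `x`, that is,
`φ(m, x_{|n})`. -/
def cocSeq (m : ℤ) (x : InfPath A) : ℕ → ℤ
  | 0 => m
  | n + 1 => coc B (cocSeq m x n) (x.1 n)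

/-- The action `κ_m` on infinite paths, determined by
`κ_m(γ y) = κ_m(γ) κ_{φ(m, γ)}(y)` for edges `γ`. -/
def act (m : ℤ) (x : InfPath A) : InfPath A :=
  ⟨fun n => Katsura.act B (cocSeq B m x n) (x.1 n), fun n => x.2 n⟩

theorem start_shift (x : InfPath A) : (shift x).start = (x.1 0).tgt := (x.2 0).symm

@[simp] theorem start_act (m : ℤ) (x : InfPath A) : (act B m x).start = x.start := rfl

theorem cocSeq_shift (m : ℤ) (x : InfPath A) (n : ℕ) :
    cocSeq B (coc B m (x.1 0)) (shift x) n = cocSeq B m x (n + 1) := by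
  induction n with
  | zero => rfl
  | succ n ih => rw [cocSeq, ih]; rfl

theorem act_shift (m : ℤ) (x : InfPath A) :
    act B (coc B m (x.1 0)) (shift x) = shift (act B m x) := by
  apply Subtype.ext
  funext n
  change Katsura.act B (cocSeq B _ (shift x) n) _ = Katsura.act B _ _
  rw [cocSeq_shift]
  rfl

theorem cocSeq_add (m n : ℤ) (x : InfPath A) (i : ℕ) :
    cocSeq B (m + n) x i = cocSeq B m (act B n x) i + cocSeq B n x i := by
  induction i with
  | zero => rfl
  | succ i ih =>
    rw [cocSeq, ih, (act_coc_add B _ _ _).2]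
    rfl

theorem act_add (m n : ℤ) (x : InfPath A) : act B (m + n) x = act B m (act B n x) := by
  apply Subtype.ext
  funext i
  change Katsura.act B _ _ = Katsura.act B _ (Katsura.act B _ _)
  rw [cocSeq_add, (act_coc_add B _ _ _).1]

theorem cocSeq_zero (x : InfPath A) (i : ℕ) : cocSeq B 0 x i = 0 := by
  induction i with
  | zero => rfl
  | succ i ih => rw [cocSeq, ih, (act_coc_zero B _).2]

theorem act_zero (x : InfPath A) : act B 0 x = x := by
  apply Subtype.ext
  funext i
  change Katsura.act B _ _ = _
  rw [cocSeq_zero, (act_coc_zero B _).1]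

theorem ext_of {x y : InfPath A} (h0 : x.1 0 = y.1 0) (h : shift x = shift y) : x = y := by
  apply Subtype.ext
  funext n
  cases n with
  | zero => exact h0
  | succ n => exact congrFun (congrArg Subtype.val h) n

end InfPath

/-- `IsWalk v l w`: the edges in the list `l` form a path from `v` to `w`. -/
def IsWalk : Fin N → List (Edge A) → Fin N → Prop
  | v, [], w => v = w
  | v, e :: l, w => e.src = v ∧ IsWalk e.tgt l w

/-- The finite paths of the graph; those without edges are the vertices. -/
structure FinPath (A : Matrix (Fin N) (Fin N) ℤ) where
  src : Fin N
  tgt : Fin N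
  edges : List (Edge A)
  isWalk : IsWalk src edges tgt

theorem IsWalk.tgt_unique {v w w' : Fin N} {l : List (Edge A)} (h : IsWalk v l w)
    (h' : IsWalk v l w') : w = w' := by
  induction l generalizing v with
  | nil => exact h.symm.trans h'
  | cons e l ih => exact ih h.2 h'.2

theorem IsWalk.snoc {v w : Fin N} {l : List (Edge A)} (h : IsWalk v l w) (e : Edge A)
    (he : w = e.src) : IsWalk v (l ++ [e]) e.tgt := by
  induction l generalizing v with
  | nil => exact ⟨he.symm.trans (Eq.symm h), rfl⟩
  | cons f l ih => exact ⟨h.1, ih h.2⟩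

/-- The sequence that starts with the list `l` and continues with the sequence `y`. -/
def prepend {X : Type*} : List X → (ℕ → X) → ℕ → X
  | [], y => y
  | e :: l, y => fun n => Nat.casesOn n e (prepend l y)

theorem prepend_snoc {X : Type*} (l : List X) (y : ℕ → X) :
    prepend (l ++ [y 0]) (fun n => y (n + 1)) = prepend l y := by
  induction l with
  | nil =>
    funext n
    cases n <;> rfl
  | cons e l ih =>
    funext n
    cases n with
    | zero => rfl
    | succ n => exact congrFun ih n

theorem prepend_inj {X : Type*} {l l' : List X} {y y' : ℕ → X} (hl : l.length = l'.length)
    (h : prepend l y = prepend l' y') : l = l' ∧ y = y' := by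
  induction l generalizing l' with
  | nil =>
    cases l' with
    | nil => exact ⟨rfl, h⟩
    | cons e l' => simp at hl
  | cons e l ih =>
    cases l' with
    | nil => simp at hl
    | cons e' l' =>
      have h0 : e = e' := congrFun h 0
      have h1 : prepend l y = prepend l' y' := funext fun n => congrFun h (n + 1)
      obtain ⟨h2, h3⟩ := ih (by simpa using hl) h1
      exact ⟨by rw [h0, h2], h3⟩

theorem IsWalk.prepend_zero {v : Fin N} {l : List (Edge A)} {y : InfPath A}
    (h : IsWalk v l y.start) : (prepend l y.1 0).src = v := by
  cases l with
  | nil => exact Eq.symm h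
  | cons e l => exact h.1

theorem IsWalk.prepend_infPath {v : Fin N} {l : List (Edge A)} {y : InfPath A}
    (h : IsWalk v l y.start) (n : ℕ) :
    (prepend l y.1 n).tgt = (prepend l y.1 (n + 1)).src := by
  induction l generalizing v n with
  | nil => exact y.2 n
  | cons e l ih =>
    cases n with
    | zero => exact (IsWalk.prepend_zero h.2).symm
    | succ n => exact ih h.2 n

namespace FinPath

theorem ext_of {α β : FinPath A} (hs : α.src = β.src) (h : α.edges = β.edges) : α = β := by
  obtain ⟨s, t, l, w⟩ := α
  obtain ⟨s', t', l', w'⟩ := β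
  cases hs
  cases h
  cases w.tgt_unique w'
  rfl

/-- The path of length zero at a vertex. -/
def vertex (v : Fin N) : FinPath A := ⟨v, v, [], rfl⟩

/-- The finite path `α e`, for an edge `e` with source the range of `α`. -/
def snoc (α : FinPath A) (e : Edge A) (h : α.tgt = e.src) : FinPath A :=
  ⟨α.src, e.tgt, α.edges ++ [e], α.isWalk.snoc e h⟩

/-- The infinite path `α y`, for an infinite path `y` with source the range of `α`. -/
def append (α : FinPath A) (y : InfPath A) (h : α.tgt = y.start) : InfPath A :=
  ⟨prepend α.edges y.1, IsWalk.prepend_infPath (h ▸ α.isWalk)⟩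

/-- `Z(β)`, the set of all infinite paths of the form `β y`. -/
def cylinder (β : FinPath A) : Set (InfPath A) :=
  {x | ∃ (y : InfPath A) (h : β.tgt = y.start), x = β.append y h}

theorem append_snoc (α : FinPath A) (y : InfPath A) (h : α.tgt = y.start) :
    (α.snoc (y.1 0) h).append y.shift (InfPath.start_shift y).symm = α.append y h :=
  Subtype.ext (prepend_snoc α.edges y.1)

theorem start_append (α : FinPath A) (y : InfPath A) (h : α.tgt = y.start) :
    (α.append y h).start = α.src :=
  IsWalk.prepend_zero (h ▸ α.isWalk)

theorem append_inj {α β : FinPath A} {y z : InfPath A} {hα : α.tgt = y.start}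
    {hβ : β.tgt = z.start} (hl : α.edges.length = β.edges.length)
    (h : α.append y hα = β.append z hβ) : α = β ∧ y = z := by
  obtain ⟨h1, h2⟩ := prepend_inj hl (congrArg Subtype.val h)
  refine ⟨ext_of ?_ h1, Subtype.ext h2⟩
  rw [← start_append α y hα, h, start_append]

theorem snoc_inj {α β : FinPath A} {e f : Edge A} {hα : α.tgt = e.src} {hβ : β.tgt = f.src}
    (h : α.snoc e hα = β.snoc f hβ) : α = β ∧ e = f := by
  have h1 : α.edges ++ [e] = β.edges ++ [f] := congrArg FinPath.edges h
  have h2 : α.src = β.src := (congrArg FinPath.src h :)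
  obtain ⟨h3, h4⟩ := List.append_inj' h1 rfl
  exact ⟨ext_of h2 h3, by simpa using h4⟩

end FinPath

/-- The quadruples `(α, m, β; x)` with `α, β` finite paths with the same range, `m` an integer and
`x ∈ Z(β)`. The point `x = β y` is recorded through its tail `y`. -/
structure Quad (A : Matrix (Fin N) (Fin N) ℤ) where
  α : FinPath A
  m : ℤ
  β : FinPath A
  y : InfPath A
  hα : α.tgt = y.start
  hβ : β.tgt = y.start

namespace Quad

/-- The point `x = β y` of the quadruple `(α, m, β; x)`. -/
def pt (q : Quad A) : InfPath A := q.β.append q.y q.hβ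

/-- The infinite path `α κ_m(y)`. -/
def im (q : Quad A) : InfPath A := q.α.append (q.y.act B q.m) (q.hα.trans (InfPath.start_act B _ _).symm)

/-- For `x = β γ y'` with `γ` an edge, the quadruple `(α κ_m(γ), φ(m, γ), β γ; x)`. -/
def step (q : Quad A) : Quad A where
  α := q.α.snoc (act B q.m (q.y.1 0)) q.hα
  m := coc B q.m (q.y.1 0)
  β := q.β.snoc (q.y.1 0) q.hβ
  y := q.y.shift
  hα := (InfPath.start_shift q.y).symm
  hβ := (InfPath.start_shift q.y).symm

theorem ext_of {p q : Quad A} (h1 : p.α = q.α) (h2 : p.m = q.m) (h3 : p.β = q.β)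
    (h4 : p.y = q.y) : p = q := by
  cases p
  cases q
  cases h1
  cases h2
  cases h3
  cases h4
  rfl

theorem pt_step (q : Quad A) : (q.step B).pt = q.pt := FinPath.append_snoc q.β q.y q.hβ

theorem im_step (q : Quad A) : (q.step B).im B = q.im B := by
  refine Eq.trans (Subtype.ext ?_) (FinPath.append_snoc q.α (q.y.act B q.m) q.hα)
  change prepend _ (InfPath.act B (coc B q.m (q.y.1 0)) q.y.shift).1 = _
  rw [InfPath.act_shift]
  rfl

/-- The quadruple `(β, -m, α; α κ_m(y))`. -/
def inv (q : Quad A) : Quad A :=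
  ⟨q.β, -q.m, q.α, q.y.act B q.m, q.hβ.trans (InfPath.start_act B _ _).symm,
    q.hα.trans (InfPath.start_act B _ _).symm⟩

theorem inv_step (q : Quad A) : (q.step B).inv B = (q.inv B).step B := by
  have h := act_coc_add B (-q.m) q.m (q.y.1 0)
  rw [neg_add_cancel, (act_coc_zero B _).1, (act_coc_zero B _).2] at h
  apply ext_of
  · exact FinPath.ext_of rfl (congrArg (fun e => q.β.edges ++ [e]) h.1)
  · change -coc B q.m (q.y.1 0) = coc B (-q.m) (act B q.m (q.y.1 0))
    linarith [h.2]
  · rfl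
  · exact InfPath.act_shift B q.m q.y

/-- `p` and `q` are of the form `(α, m', β; β κ_m(y))` and `(β, m, γ; γ y)`. -/
def Matched (p q : Quad A) : Prop := p.β = q.α ∧ p.y = q.y.act B q.m

/-- The product `(α, m', β; β κ_m(y)) (β, m, γ; γ y) = (α, m' + m, γ; γ y)`. -/
def comp (p q : Quad A) (h : Matched B p q) : Quad A :=
  ⟨p.α, p.m + q.m, q.β, q.y, by rw [p.hα, h.2]; rfl, q.hβ⟩

theorem matched_step {p q : Quad A} : Matched B (p.step B) (q.step B) ↔ Matched B p q := by
  constructor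
  · rintro ⟨h1, h2⟩
    obtain ⟨h3, h4⟩ := FinPath.snoc_inj (f := act B q.m (q.y.1 0)) (hα := p.hβ) (hβ := q.hα) h1
    refine ⟨h3, InfPath.ext_of h4 ?_⟩
    rw [← InfPath.act_shift]
    exact h2
  · rintro ⟨h1, h2⟩
    constructor
    · refine FinPath.ext_of (congrArg FinPath.src h1 :) ?_
      change p.β.edges ++ [p.y.1 0] = q.α.edges ++ [act B q.m (q.y.1 0)]
      rw [h1, h2]
      rfl
    · change p.y.shift = InfPath.act B (coc B q.m (q.y.1 0)) q.y.shift
      rw [InfPath.act_shift, h2]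

theorem comp_step {p q : Quad A} (h : Matched B p q) (h' : Matched B (p.step B) (q.step B)) :
    comp B (p.step B) (q.step B) h' = (comp B p q h).step B := by
  have h1 : p.y.1 0 = act B q.m (q.y.1 0) := by rw [h.2]; rfl
  have h2 := act_coc_add B p.m q.m (q.y.1 0)
  refine ext_of ?_ ?_ rfl rfl
  · refine FinPath.ext_of rfl (congrArg (fun e => p.α.edges ++ [e]) ?_)
    change act B p.m (p.y.1 0) = act B (p.m + q.m) (q.y.1 0)
    rw [h1, h2.1]
  · change coc B p.m (p.y.1 0) + coc B q.m (q.y.1 0) = coc B (p.m + q.m) (q.y.1 0)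
    rw [h1, h2.2]

open Classical in
/-- The product of two quadruples that are matched, and a junk value otherwise. -/
noncomputable def compOr (p q : Quad A) : Quad A :=
  if h : Matched B p q then comp B p q h else p

/-- Refine one of the two quadruples until the two middle paths have the same length, then
multiply. -/
noncomputable def mul (p q : Quad A) : Quad A :=
  compOr B ((step B)^[q.α.edges.length - p.β.edges.length] p)
    ((step B)^[p.β.edges.length - q.α.edges.length] q)

end Quad

/-- The set underlying the Katsura-Exel-Pardo groupoid: the quadruples modulo the equivalence
relation generated by `(α, m, β; x) ∼ (α κ_m(γ), φ(m, γ), β γ; x)` for `x = β γ y'`. -/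
def KEP (A B : Matrix (Fin N) (Fin N) ℤ) : Type := Quot fun q q' : Quad A => q' = q.step B

namespace KEP

variable {B}

/-- The class `[α, m, β; x]` of a quadruple. -/
def mk (q : Quad A) : KEP A B := Quot.mk _ q

theorem mk_step (q : Quad A) : (mk (q.step B) : KEP A B) = mk q :=
  (Quot.sound (r := fun q q' : Quad A => q' = q.step B) rfl).symm

theorem mk_iterate (n : ℕ) (q : Quad A) : (mk ((Quad.step B)^[n] q) : KEP A B) = mk q := by
  induction n generalizing q with
  | zero => rfl
  | succ n ih => rw [Function.iterate_succ_apply, ih, mk_step]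

/-- The source of an arrow as an infinite path, `s([α, m, β; x]) = x`. -/
def s : KEP A B → InfPath A := Quot.lift Quad.pt (by rintro q _ rfl; exact (q.pt_step B).symm)

/-- The range of an arrow as an infinite path, `r([α, m, β; β y]) = α κ_m(y)`. -/
def r : KEP A B → InfPath A :=
  Quot.lift (Quad.im B) (by rintro q _ rfl; exact (q.im_step B).symm)

/-- The unit `[v, 0, v; x]`, where `v` is the source of `x`. -/
def unit (x : InfPath A) : KEP A B :=
  mk ⟨FinPath.vertex x.start, 0, FinPath.vertex x.start, x, rfl, rfl⟩

/-- The inverse `[α, m, β; β y]⁻¹ = [β, -m, α; α κ_m(y)]`. -/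
def inv : KEP A B → KEP A B :=
  Quot.lift (fun q => mk (q.inv B)) (by rintro q _ rfl; rw [Quad.inv_step, mk_step])

theorem mk_compOr_step (p q : Quad A) :
    (mk (Quad.compOr B (p.step B) (q.step B)) : KEP A B) = mk (Quad.compOr B p q) := by
  by_cases h : Quad.Matched B p q
  · have h' := (Quad.matched_step B).2 h
    rw [Quad.compOr, Quad.compOr, dif_pos h, dif_pos h', Quad.comp_step B h h', mk_step]
  · have h' := fun c => h ((Quad.matched_step B).1 c)
    rw [Quad.compOr, Quad.compOr, dif_neg h, dif_neg h', mk_step]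

theorem length_iterate (n : ℕ) (q : Quad A) :
    ((Quad.step B)^[n] q).α.edges.length = q.α.edges.length + n ∧
      ((Quad.step B)^[n] q).β.edges.length = q.β.edges.length + n := by
  induction n generalizing q with
  | zero => exact ⟨rfl, rfl⟩
  | succ n ih =>
    rw [Function.iterate_succ_apply, (ih _).1, (ih _).2]
    simp [Quad.step, FinPath.snoc]
    omega

theorem length_step (q : Quad A) :
    (q.step B).α.edges.length = q.α.edges.length + 1 ∧
      (q.step B).β.edges.length = q.β.edges.length + 1 :=
  length_iterate 1 q

theorem mk_mul_step_left (p q : Quad A) :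
    (mk (Quad.mul B (p.step B) q) : KEP A B) = mk (Quad.mul B p q) := by
  rw [Quad.mul, Quad.mul, (length_step p).2]
  by_cases h : q.α.edges.length ≤ p.β.edges.length
  · rw [Nat.sub_eq_zero_of_le h, Nat.sub_eq_zero_of_le (by omega : _ ≤ p.β.edges.length + 1),
      Nat.sub_add_comm h, Function.iterate_succ_apply']
    exact mk_compOr_step _ _
  · obtain ⟨k, hk⟩ : ∃ k, q.α.edges.length - p.β.edges.length = k + 1 :=
      ⟨q.α.edges.length - p.β.edges.length - 1, by omega⟩
    rw [hk, (by omega : q.α.edges.length - (p.β.edges.length + 1) = k),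
      (by omega : p.β.edges.length + 1 - q.α.edges.length = 0),
      (by omega : p.β.edges.length - q.α.edges.length = 0), Function.iterate_succ_apply]

theorem mk_mul_step_right (p q : Quad A) :
    (mk (Quad.mul B p (q.step B)) : KEP A B) = mk (Quad.mul B p q) := by
  rw [Quad.mul, Quad.mul, (length_step q).1]
  by_cases h : p.β.edges.length ≤ q.α.edges.length
  · rw [Nat.sub_eq_zero_of_le h, Nat.sub_eq_zero_of_le (by omega : _ ≤ q.α.edges.length + 1),
      Nat.sub_add_comm h, Function.iterate_succ_apply']
    exact mk_compOr_step _ _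
  · obtain ⟨k, hk⟩ : ∃ k, p.β.edges.length - q.α.edges.length = k + 1 :=
      ⟨p.β.edges.length - q.α.edges.length - 1, by omega⟩
    rw [hk, (by omega : p.β.edges.length - (q.α.edges.length + 1) = k),
      (by omega : q.α.edges.length + 1 - p.β.edges.length = 0),
      (by omega : q.α.edges.length - p.β.edges.length = 0), Function.iterate_succ_apply]

/-- The product of arrows (a junk value if they are not composable). It is the map with
`[α, m', β; β κ_m(y)] [β, m, γ; γ y] = [α, m' + m, γ; γ y]`, see `mul_mk`. -/
noncomputable def mul : KEP A B → KEP A B → KEP A B :=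
  Quot.lift₂ (fun p q => mk (Quad.mul B p q))
    (by rintro p q _ rfl; exact (mk_mul_step_right p q).symm)
    (by rintro p _ q rfl; exact (mk_mul_step_left p q).symm)

theorem mul_mk {p q : Quad A} (h : Quad.Matched B p q) :
    mul (mk p) (mk q) = (mk (Quad.comp B p q h) : KEP A B) := by
  change mk (Quad.mul B p q) = _
  rw [Quad.mul, h.1, Nat.sub_self, Quad.compOr]
  exact congrArg mk (dif_pos h)

theorem matched_iterate {p q : Quad A} (h : Quad.Matched B p q) (n : ℕ) :
    Quad.Matched B ((Quad.step B)^[n] p) ((Quad.step B)^[n] q) := by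
  induction n generalizing p q with
  | zero => exact h
  | succ n ih => exact ih ((Quad.matched_step B).2 h)

theorem matched_of {p q : Quad A} (hl : p.β.edges.length = q.α.edges.length)
    (h : p.pt = q.im B) : Quad.Matched B p q :=
  FinPath.append_inj hl h

theorem exists_matched (p q : Quad A) (h : s (mk p : KEP A B) = r (mk q : KEP A B)) :
    ∃ a b, Quad.Matched B ((Quad.step B)^[a] p) ((Quad.step B)^[b] q) := by
  refine ⟨q.α.edges.length, p.β.edges.length, matched_of ?_ ?_⟩
  · rw [(length_iterate _ _).1, (length_iterate _ _).2, add_comm]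
  · change s (mk _ : KEP A B) = r (mk _ : KEP A B)
    rw [mk_iterate, mk_iterate, h]

theorem exists_rep₂ (g h : KEP A B) (c : s g = r h) :
    ∃ p q, Quad.Matched B p q ∧ g = mk p ∧ h = mk q := by
  obtain ⟨p, rfl⟩ := Quot.exists_rep g
  obtain ⟨q, rfl⟩ := Quot.exists_rep h
  obtain ⟨a, b, hm⟩ := exists_matched p q c
  exact ⟨_, _, hm, (mk_iterate _ _).symm, (mk_iterate _ _).symm⟩

theorem exists_rep₃ (g h k : KEP A B) (c : s g = r h) (d : s h = r k) :
    ∃ p q t, Quad.Matched B p q ∧ Quad.Matched B q t ∧ g = mk p ∧ h = mk q ∧ k = mk t := by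
  obtain ⟨p, q, hm, rfl, rfl⟩ := exists_rep₂ g h c
  obtain ⟨t, rfl⟩ := Quot.exists_rep k
  obtain ⟨a, b, hm'⟩ := exists_matched q t d
  exact ⟨_, _, _, matched_iterate hm a, hm', (mk_iterate _ _).symm, (mk_iterate _ _).symm,
    (mk_iterate _ _).symm⟩

theorem s_unit (x : InfPath A) : s (unit x : KEP A B) = x := rfl

theorem r_unit (x : InfPath A) : r (unit x : KEP A B) = x := InfPath.act_zero B x

theorem unit_inj {x y : InfPath A} (h : (unit x : KEP A B) = unit y) : x = y :=
  congrArg s h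

theorem s_mul (g h : KEP A B) (c : s g = r h) : s (mul g h) = s h := by
  obtain ⟨p, q, hm, rfl, rfl⟩ := exists_rep₂ g h c
  rw [mul_mk hm]
  rfl

theorem r_mul (g h : KEP A B) (c : s g = r h) : r (mul g h) = r g := by
  obtain ⟨p, q, hm, rfl, rfl⟩ := exists_rep₂ g h c
  rw [mul_mk hm]
  apply Subtype.ext
  change prepend p.α.edges (InfPath.act B (p.m + q.m) q.y).1 = prepend p.α.edges _
  rw [InfPath.act_add, ← hm.2]

theorem s_inv (g : KEP A B) : s (inv g) = r g := by
  obtain ⟨p, rfl⟩ := Quot.exists_rep g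
  rfl

theorem r_inv (g : KEP A B) : r (inv g) = s g := by
  obtain ⟨p, rfl⟩ := Quot.exists_rep g
  apply Subtype.ext
  change prepend p.β.edges (InfPath.act B (-p.m) (InfPath.act B p.m p.y)).1 = prepend _ p.y.1
  rw [← InfPath.act_add, neg_add_cancel, InfPath.act_zero]

theorem mul_assoc (g h k : KEP A B) (c : s g = r h) (d : s h = r k) :
    mul (mul g h) k = mul g (mul h k) := by
  obtain ⟨p, q, t, h1, h2, rfl, rfl, rfl⟩ := exists_rep₃ g h k c d
  have h3 : Quad.Matched B (Quad.comp B p q h1) t := h2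
  have h4 : Quad.Matched B p (Quad.comp B q t h2) := by
    refine ⟨h1.1, ?_⟩
    rw [h1.2, h2.2]
    exact (InfPath.act_add B _ _ _).symm
  rw [mul_mk h1, mul_mk h2, mul_mk h3, mul_mk h4]
  exact congrArg mk (Quad.ext_of rfl (add_assoc _ _ _) rfl rfl)

/-- The class of `(α, 0, α; α y)` is a unit. -/
theorem mk_eq_unit (α : FinPath A) (y : InfPath A) (h : α.tgt = y.start) :
    (mk ⟨α, 0, α, y, h, h⟩ : KEP A B) = unit (α.append y h) := by
  have key : ∀ (n : ℕ) (α' : FinPath A) (z : InfPath A) (h' : α'.tgt = z.start),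
      ∃ α'' z' h'', (Quad.step B)^[n] ⟨α', 0, α', z, h', h'⟩ = ⟨α'', 0, α'', z', h'', h''⟩ := by
    intro n
    induction n with
    | zero => exact fun α' z h' => ⟨α', z, h', rfl⟩
    | succ n ih =>
      intro α' z h'
      obtain ⟨α'', z', h'', e⟩ := ih (α'.snoc (z.1 0) h') z.shift (InfPath.start_shift z).symm
      refine ⟨α'', z', h'', ?_⟩
      rw [Function.iterate_succ_apply, ← e]
      congr 1
      refine Quad.ext_of ?_ (act_coc_zero B _).2 rfl rfl
      exact FinPath.ext_of rfl (congrArg (fun e => α'.edges ++ [e]) (act_coc_zero B _).1)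
  set q : Quad A := ⟨FinPath.vertex (α.append y h).start, 0,
    FinPath.vertex (α.append y h).start, α.append y h, rfl, rfl⟩ with hq
  obtain ⟨α', z, h', e⟩ := key α.edges.length (FinPath.vertex (α.append y h).start)
    (α.append y h) rfl
  have e1 : (mk q : KEP A B) = mk ⟨α', 0, α', z, h', h'⟩ := by
    rw [← e, mk_iterate]
  have e2 : α'.edges.length = α.edges.length := by
    have := (length_iterate (B := B) α.edges.length q).1
    rw [hq, e] at this
    simpa [FinPath.vertex] using this
  have e3 : α'.append z h' = α.append y h := (congrArg s e1).symm
  obtain ⟨e4, e5⟩ := FinPath.append_inj e2 e3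
  subst e4
  subst e5
  exact e1.symm

theorem mul_unit (g : KEP A B) : mul g (unit (s g)) = g := by
  obtain ⟨p, rfl⟩ := Quot.exists_rep g
  have hm : Quad.Matched B p ⟨p.β, 0, p.β, p.y, p.hβ, p.hβ⟩ :=
    ⟨rfl, (InfPath.act_zero B _).symm⟩
  have h := mk_eq_unit (B := B) p.β p.y p.hβ
  refine Eq.trans (congrArg (mul (mk p)) h.symm) ((mul_mk hm).trans ?_)
  exact congrArg mk (Quad.ext_of rfl (add_zero _) rfl rfl)

theorem unit_mul (g : KEP A B) : mul (unit (r g)) g = g := by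
  obtain ⟨p, rfl⟩ := Quot.exists_rep g
  have hm : Quad.Matched B ⟨p.α, 0, p.α, p.y.act B p.m, p.hα, p.hα⟩ p := ⟨rfl, rfl⟩
  have h := mk_eq_unit (B := B) p.α (p.y.act B p.m) p.hα
  refine Eq.trans (congrArg (fun k => mul k (mk p)) h.symm) ((mul_mk hm).trans ?_)
  exact congrArg mk (Quad.ext_of rfl (zero_add _) rfl rfl)

theorem mul_inv (g : KEP A B) : mul g (inv g) = unit (r g) := by
  obtain ⟨p, rfl⟩ := Quot.exists_rep g
  have hm : Quad.Matched B p (p.inv B) := by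
    refine ⟨rfl, ?_⟩
    change p.y = InfPath.act B (-p.m) (InfPath.act B p.m p.y)
    rw [← InfPath.act_add, neg_add_cancel, InfPath.act_zero]
  refine (mul_mk hm).trans (Eq.trans ?_ (mk_eq_unit p.α (p.y.act B p.m) p.hα))
  exact congrArg mk (Quad.ext_of rfl (add_neg_cancel _) rfl rfl)

theorem inv_mul (g : KEP A B) : mul (inv g) g = unit (s g) := by
  obtain ⟨p, rfl⟩ := Quot.exists_rep g
  have hm : Quad.Matched B (p.inv B) p := ⟨rfl, rfl⟩
  refine (mul_mk hm).trans (Eq.trans ?_ (mk_eq_unit p.β p.y p.hβ))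
  exact congrArg mk (Quad.ext_of rfl (neg_add_cancel _) rfl rfl)

/-- The Katsura-Exel-Pardo groupoid. -/
noncomputable instance : ArrowGroupoid (KEP A B) where
  src g := unit (s g)
  rng g := unit (r g)
  inv := inv
  mul g h _ := mul g h
  src_src _ := rfl
  rng_src g := congrArg unit (r_unit (s g))
  src_rng _ := rfl
  rng_rng g := congrArg unit (r_unit (r g))
  src_mul g h c := congrArg unit (s_mul g h (unit_inj c))
  rng_mul g h c := congrArg unit (r_mul g h (unit_inj c))
  mul_assoc g h k c d := mul_assoc g h k (unit_inj c) (unit_inj d)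
  mul_src := mul_unit
  rng_mul_self := unit_mul
  src_inv g := congrArg unit (s_inv g)
  rng_inv g := congrArg unit (r_inv g)
  mul_inv := mul_inv
  inv_mul := inv_mul

/-- `Z(α, m, β; U)`, the set of all `[α, m, β; x]` with `x ∈ U`. -/
def basicSet (α : FinPath A) (m : ℤ) (β : FinPath A) (U : Set (InfPath A)) : Set (KEP A B) :=
  {g | ∃ q : Quad A, q.α = α ∧ q.m = m ∧ q.β = β ∧ q.pt ∈ U ∧ g = mk q}

/-- The topology generated by the sets `Z(α, m, β; U)`, where `α` and `β` have the same range and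
`U` is a compact open subset of `Z(β)`. -/
instance : TopologicalSpace (KEP A B) :=
  TopologicalSpace.generateFrom
    {V | ∃ (α : FinPath A) (m : ℤ) (β : FinPath A) (U : Set (InfPath A)), α.tgt = β.tgt ∧
      IsCompact U ∧ IsOpen U ∧ U ⊆ β.cylinder ∧ V = basicSet α m β U}

end KEP

end Katsura

/-!
Two dimensions attached to an ample groupoid `G` are isomorphism invariants: that of the space of
invariant finitely additive measures on the unit space, and that of the space of additive cocycles
on compact open bisections modulo coboundaries.

For an open set `S` of units of the Katsura–Exel–Pardo groupoid, the bisections `Z(α, m, β)` with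
`Z(α), Z(β) ⊆ S` form a tree, in which `Z(α, m, β)` is split by the edges leaving `r(β)`;
pseudo-freeness makes distinct bisections of equal depth disjoint. Hence functionals on compact open
bisections are the same as harmonic weights on triples `(α, m, β)`. Invariant measures become
`β ↦ x(r(β))` with `A_S x = x`, where `A_S` is the block of `A` on the vertices reached from `S`.
Cocycles become `(α, m, β) ↦ a(α) + m b(r(β)) - a(β)`, and harmonicity says `B_S b = b` and that the
Laplacian of `a` is a function of the range; modulo coboundaries this gives
`ker (1 - B_S) × coker (1 - A_S)`.

If `S` is full, compactness of the path space gives an `L` such that all paths of length `L` end in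
the vertices reached from `S`, so that `1 - M` and `1 - M_S` have isomorphic kernels for `M = A, B`.
Kernels of integer matrices are free, so their ranks decide.
-/

section Decomposition

variable {X Y ι : Type*} {C : ι → Set X} {F : Finset ι} {U : Set X}

/-- The sets `C i`, for `i` in the finite set `F`, are pairwise disjoint and their union is `U`. -/
structure IsDecomposition (C : ι → Set X) (F : Finset ι) (U : Set X) : Prop where
  pairwiseDisjoint : (F : Set ι).PairwiseDisjoint C
  iUnion_eq : ⋃ i ∈ F, C i = U

namespace IsDecomposition

theorem subset (h : IsDecomposition C F U) {i : ι} (hi : i ∈ F) : C i ⊆ U :=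
  h.iUnion_eq ▸ Set.subset_biUnion_of_mem (u := C) hi

theorem indicator_eq_sum {R : Type*} [AddCommMonoid R] (h : IsDecomposition C F U) (f : X → R) :
    U.indicator f = ∑ i ∈ F, (C i).indicator f := by
  rw [← h.iUnion_eq, Finset.indicator_biUnion F C h.pairwiseDisjoint, Finset.sum_fn]

theorem map_indicator {R M L : Type*} [AddCommMonoid R] [AddCommMonoid M] [FunLike L (X → R) M]
    [AddMonoidHomClass L (X → R) M] (h : IsDecomposition C F U) (l : L) (f : X → R) :
    l (U.indicator f) = ∑ i ∈ F, l ((C i).indicator f) := by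
  rw [h.indicator_eq_sum, map_sum]

theorem congr {C' : ι → Set X} (h : IsDecomposition C F U) (hC : ∀ i ∈ F, C i = C' i) :
    IsDecomposition C' F U where
  pairwiseDisjoint i hi j hj hij := by
    rw [Function.onFun_apply, ← hC i hi, ← hC j hj]
    exact h.pairwiseDisjoint hi hj hij
  iUnion_eq := (Set.iUnion₂_congr hC).symm.trans h.iUnion_eq

theorem image {f : X → Y} (h : IsDecomposition C F U) (hf : U.InjOn f) :
    IsDecomposition (fun i => f '' C i) F (f '' U) where
  pairwiseDisjoint i hi j hj hij :=
    Set.disjoint_image_image fun x hx y hy hxy => (h.pairwiseDisjoint hi hj hij).ne_of_mem hx hy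
      (hf (h.subset hi hx) (h.subset hj hy) hxy)
  iUnion_eq := by rw [← h.iUnion_eq, Set.image_iUnion₂]

theorem of_image {f : X → Y} (hf : U.InjOn f) (hC : ∀ i ∈ F, C i ⊆ U)
    (h : IsDecomposition (fun i => f '' C i) F (f '' U)) : IsDecomposition C F U where
  pairwiseDisjoint i hi j hj hij := .of_image (h.pairwiseDisjoint hi hj hij)
  iUnion_eq := by
    refine (hf.image_eq_image_iff (Set.iUnion₂_subset hC) subset_rfl).1 ?_
    rw [Set.image_iUnion₂, h.iUnion_eq]

end IsDecomposition

theorem linearIndepOn_indicator_one {R : Type*} [Ring R] {s : Set ι}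
    (hC : ∀ i ∈ s, (C i).Nonempty) (hs : s.PairwiseDisjoint C) :
    LinearIndepOn R (fun i => (C i).indicator (1 : X → R)) s := by
  refine linearIndepOn_iff.2 fun a ha hsum => Finsupp.ext fun i => ?_
  by_contra hai
  have hi : i ∈ a.support := Finsupp.mem_support_iff.2 hai
  obtain ⟨x, hx⟩ := hC i (ha hi)
  have hzero (j : ι) (hj : j ∈ a.support) (hji : j ≠ i) : x ∉ C j := fun hxj =>
    (hs (ha hj) (ha hi) hji).ne_of_mem hxj hx rfl
  refine hai ?_
  calc a i = ∑ j ∈ a.support, a j • (C j).indicator (1 : X → R) x := by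
        rw [Finset.sum_eq_single_of_mem i hi fun j hj hji => by simp [hzero j hj hji]]
        simp [hx]
    _ = 0 := by simpa [Finsupp.linearCombination_apply, Finsupp.sum] using congrFun hsum x

end Decomposition

/-- A tree of nonempty subsets of `X`: every set is the union of the sets of its finitely many
children, and distinct sets of the same level are disjoint. -/
structure SetTree (X T : Type*) where
  cell : T → Set X
  level : T → ℕ
  children : T → Finset T
  cell_nonempty : ∀ t, (cell t).Nonempty
  iUnion_cell_children : ∀ t, ⋃ c ∈ children t, cell c = cell t
  level_child : ∀ t, ∀ c ∈ children t, level c = level t + 1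
  disjoint_cell : ∀ t t', level t = level t' → t ≠ t' → Disjoint (cell t) (cell t')

namespace SetTree

variable {X T : Type*} (𝒯 : SetTree X T)

theorem isDecomposition_children (t : T) :
    IsDecomposition 𝒯.cell (𝒯.children t) (𝒯.cell t) where
  pairwiseDisjoint c hc c' hc' hne := 𝒯.disjoint_cell c c'
    ((𝒯.level_child t c hc).trans (𝒯.level_child t c' hc').symm) hne
  iUnion_eq := 𝒯.iUnion_cell_children t

/-- A weight on a tree of sets is harmonic if it is the sum of the weights of the children. -/
def IsHarmonic {M : Type*} [AddCommMonoid M] (w : T → M) : Prop :=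
  ∀ t, w t = ∑ c ∈ 𝒯.children t, w c

/-- A property of vertices of the tree is hereditary if it passes to children. -/
def IsHereditary (P : T → Prop) : Prop := ∀ t, P t → ∀ c ∈ 𝒯.children t, P c

variable {𝒯}

theorem isHarmonic_indicator {R : Type*} [AddCommMonoid R] (f : X → R) :
    𝒯.IsHarmonic fun t => (𝒯.cell t).indicator f :=
  fun t => (𝒯.isDecomposition_children t).indicator_eq_sum f

theorem IsHarmonic.map {M M' F : Type*} [AddCommMonoid M] [AddCommMonoid M'] [FunLike F M M']
    [AddMonoidHomClass F M M'] {w : T → M} (hw : 𝒯.IsHarmonic w) (l : F) :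
    𝒯.IsHarmonic fun t => l (w t) := fun t => by
  simp only [← map_sum, ← hw t]

theorem IsHarmonic.prodMk {M M' : Type*} [AddCommMonoid M] [AddCommMonoid M'] {w : T → M}
    {w' : T → M'} (hw : 𝒯.IsHarmonic w) (hw' : 𝒯.IsHarmonic w') :
    𝒯.IsHarmonic fun t => (w t, w' t) := fun t => by
  simp only [← prod_mk_sum, ← hw t, ← hw' t]

theorem IsHereditary.exists_level_add_mem {P : T → Prop} (hP : 𝒯.IsHereditary P) {t : T}
    (ht : P t) {x : X} (hx : x ∈ 𝒯.cell t) (k : ℕ) :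
    ∃ t', 𝒯.level t' = 𝒯.level t + k ∧ P t' ∧ x ∈ 𝒯.cell t' := by
  induction k with
  | zero => exact ⟨t, rfl, ht, hx⟩
  | succ k ih =>
    obtain ⟨t', hlevel, ht', hxt'⟩ := ih
    rw [← 𝒯.iUnion_cell_children t', Set.mem_iUnion₂] at hxt'
    obtain ⟨c, hc, hxc⟩ := hxt'
    exact ⟨c, by rw [𝒯.level_child t' c hc, hlevel, add_assoc], hP t' ht' c hc, hxc⟩

theorem IsHereditary.exists_level_cover_of_isCompact [TopologicalSpace X] {P : T → Prop}
    (hP : 𝒯.IsHereditary P) (hopen : ∀ t, IsOpen (𝒯.cell t)) {U : Set X} (hU : IsCompact U)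
    (hcover : ∀ x ∈ U, ∃ t, P t ∧ x ∈ 𝒯.cell t) :
    ∃ n, ∃ F : Finset T, (∀ t ∈ F, 𝒯.level t = n ∧ P t) ∧ U ⊆ ⋃ t ∈ F, 𝒯.cell t := by
  have hmono : Monotone fun n => ⋃ t ∈ {t | 𝒯.level t = n ∧ P t}, 𝒯.cell t := by
    intro m n hmn x hx
    obtain ⟨t, ⟨rfl, ht⟩, hxt⟩ := Set.mem_iUnion₂.1 hx
    obtain ⟨t', hlevel, ht', hxt'⟩ := hP.exists_level_add_mem ht hxt (n - 𝒯.level t)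
    exact Set.mem_iUnion₂.2 ⟨t', ⟨by omega, ht'⟩, hxt'⟩
  obtain ⟨n, hn⟩ := hU.elim_directed_cover _
    (fun n => isOpen_biUnion fun t _ => hopen t)
    (fun x hx => by
      obtain ⟨t, ht, hxt⟩ := hcover x hx
      exact Set.mem_iUnion.2 ⟨𝒯.level t, Set.mem_iUnion₂.2 ⟨t, ⟨rfl, ht⟩, hxt⟩⟩)
    hmono.directed_le
  obtain ⟨F, hF, hfin, hUF⟩ := hU.elim_finite_subcover_image (fun t _ => hopen t) hn
  exact ⟨n, hfin.toFinset, fun t ht => hF (hfin.mem_toFinset.1 ht), by simpa using hUF⟩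

theorem IsHereditary.exists_isDecomposition [TopologicalSpace X] {P : T → Prop}
    (hP : 𝒯.IsHereditary P) (hopen : ∀ t, IsOpen (𝒯.cell t)) {U : Set X} (hU : IsCompact U)
    (hcover : ∀ x ∈ U, ∃ t, P t ∧ x ∈ 𝒯.cell t ∧ 𝒯.cell t ⊆ U) :
    ∃ F : Finset T, IsDecomposition 𝒯.cell F U ∧ ∀ t ∈ F, P t := by
  have hPU : 𝒯.IsHereditary fun t => P t ∧ 𝒯.cell t ⊆ U := fun t ht c hc =>
    ⟨hP t ht.1 c hc, ((𝒯.isDecomposition_children t).subset hc).trans ht.2⟩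
  obtain ⟨n, F, hF, hUF⟩ := hPU.exists_level_cover_of_isCompact hopen hU fun x hx =>
    (hcover x hx).imp fun t ht => ⟨⟨ht.1, ht.2.2⟩, ht.2.1⟩
  refine ⟨F, ⟨fun t ht t' ht' => ?_, ?_⟩, fun t ht => (hF t ht).2.1⟩
  · exact 𝒯.disjoint_cell t t' ((hF t ht).1.trans (hF t' ht').1.symm)
  · exact (Set.iUnion₂_subset fun t ht => (hF t ht).2.2).antisymm hUF

theorem IsHarmonic.mem_span_level {R M : Type*} [Semiring R] [AddCommMonoid M] [Module R M]
    {w : T → M} (hw : 𝒯.IsHarmonic w) {n : ℕ} {t : T} (ht : 𝒯.level t ≤ n) :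
    w t ∈ Submodule.span R (w '' {t | 𝒯.level t = n}) := by
  obtain ⟨k, rfl⟩ := Nat.exists_eq_add_of_le ht
  induction k generalizing t with
  | zero => exact Submodule.subset_span ⟨t, rfl, rfl⟩
  | succ k ih =>
    rw [hw t]
    refine Submodule.sum_mem _ fun c hc => ?_
    have hlevel : 𝒯.level c + k = 𝒯.level t + (k + 1) := by rw [𝒯.level_child t c hc]; omega
    exact hlevel ▸ ih (Nat.le_add_right _ _)

theorem linearIndepOn_indicator_level (R : Type*) [Ring R] (n : ℕ) :
    LinearIndepOn R (fun t => (𝒯.cell t).indicator (1 : X → R)) {t | 𝒯.level t = n} :=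
  linearIndepOn_indicator_one (fun t _ => 𝒯.cell_nonempty t) fun t ht t' ht' =>
    𝒯.disjoint_cell t t' (Eq.trans ht (Eq.symm ht'))

/- Refining to a single level makes the indicators linearly independent, so a relation between
indicators of cells is a consequence of the relations between parents and children. -/
theorem IsHarmonic.linearCombination_eq_zero {R M : Type*} [Ring R] [AddCommMonoid M]
    [Module R M] {w : T → M} (hw : 𝒯.IsHarmonic w) {a : T →₀ R}
    (ha : Finsupp.linearCombination R (fun t => (𝒯.cell t).indicator (1 : X → R)) a = 0) :
    Finsupp.linearCombination R w a = 0 := by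
  set v : T → (X → R) × M := fun t => ((𝒯.cell t).indicator 1, w t)
  have hfst (a : T →₀ R) : (Finsupp.linearCombination R v a).1 =
      Finsupp.linearCombination R (fun t => (𝒯.cell t).indicator (1 : X → R)) a :=
    Finsupp.apply_linearCombination R (LinearMap.fst R _ _) v a
  have hsnd (a : T →₀ R) : (Finsupp.linearCombination R v a).2 =
      Finsupp.linearCombination R w a :=
    Finsupp.apply_linearCombination R (LinearMap.snd R _ _) v a
  have hv : 𝒯.IsHarmonic v := (isHarmonic_indicator 1).prodMk hw
  have hmem : Finsupp.linearCombination R v a ∈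
      Submodule.span R (v '' {t | 𝒯.level t = a.support.sup 𝒯.level}) := by
    rw [Finsupp.linearCombination_apply]
    exact Submodule.sum_mem _ fun t ht =>
      Submodule.smul_mem _ _ (hv.mem_span_level (Finset.le_sup ht))
  obtain ⟨b, hb, hab⟩ := (Finsupp.mem_span_image_iff_linearCombination R).1 hmem
  have hb0 : b = 0 := linearIndepOn_iff.1 (linearIndepOn_indicator_level R _) b hb <| by
    rw [← hfst, hab, hfst, ha]
  rw [← hsnd, ← hab, hb0, map_zero, Prod.snd_zero]

theorem IsHarmonic.exists_functional {𝕜 : Type*} [Field 𝕜] {w : T → 𝕜} (hw : 𝒯.IsHarmonic w) :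
    ∃ l : (X → 𝕜) →ₗ[𝕜] 𝕜, ∀ t, l ((𝒯.cell t).indicator 1) = w t := by
  set L := Finsupp.linearCombination 𝕜 fun t => (𝒯.cell t).indicator (1 : X → 𝕜) with hL
  have hmem : Finsupp.linearCombination 𝕜 w ∈ LinearMap.range L.dualMap := by
    rw [LinearMap.range_dualMap_eq_dualAnnihilator_ker, Submodule.mem_dualAnnihilator]
    exact fun a ha => hw.linearCombination_eq_zero ha
  obtain ⟨l, hl⟩ := hmem
  refine ⟨l, fun t => ?_⟩
  simpa [hL] using LinearMap.congr_fun hl (Finsupp.single t 1)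

end SetTree

section FractionField

open scoped nonZeroDivisors

variable {R : Type*} [CommRing R] {m n m' n' : Type*} [Finite m] [Fintype n]
  [Finite m'] [Fintype n']

theorem finrank_ker_mulVecLin_map_algebraMap (K : Type*) [Field K] [Algebra R K]
    [IsFractionRing R K] (M : Matrix m n R) :
    Module.finrank K (LinearMap.ker (M.map (algebraMap R K)).mulVecLin) =
      Module.finrank R (LinearMap.ker M.mulVecLin) := by
  let ιm : (m → R) →ₗ[R] (m → K) := .pi fun i => Algebra.linearMap R K ∘ₗ .proj i
  let ιn : (n → R) →ₗ[R] (n → K) := .pi fun i => Algebra.linearMap R K ∘ₗ .proj i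
  have hcomp : (M.map (algebraMap R K)).mulVecLin.restrictScalars R ∘ₗ ιn =
      ιm ∘ₗ M.mulVecLin := by
    refine LinearMap.ext fun x => funext fun i => ?_
    exact (RingHom.map_mulVec (algebraMap R K) M x i).symm
  have hmap : (IsLocalizedModule.map R⁰ ιn ιm M.mulVecLin).extendScalarsOfIsLocalization R⁰ K =
      (M.map (algebraMap R K)).mulVecLin := by
    refine LinearMap.restrictScalars_injective R (IsLocalizedModule.linearMap_ext R⁰ ιn ιm ?_)
    rw [hcomp]
    exact IsLocalizedModule.map_comp R⁰ ιn ιm _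
  rw [← hmap, ← LinearMap.localized'_ker_eq_ker_localizedMap K R⁰ ιn ιm,
    IsFractionRing.finrank_right_eq R]
  exact IsLocalizedModule.finrank_eq R⁰ (Submodule.toLocalized' K R⁰ ιn _) le_rfl

theorem nonempty_ker_mulVecLin_linearEquiv [IsDomain R] [IsPrincipalIdealRing R] (K : Type*)
    [Field K] [Algebra R K] [IsFractionRing R K] {M : Matrix m n R} {M' : Matrix m' n' R}
    (h : Module.finrank K (LinearMap.ker (M.map (algebraMap R K)).mulVecLin) =
      Module.finrank K (LinearMap.ker (M'.map (algebraMap R K)).mulVecLin)) :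
    Nonempty (LinearMap.ker M.mulVecLin ≃ₗ[R] LinearMap.ker M'.mulVecLin) := by
  rw [finrank_ker_mulVecLin_map_algebraMap, finrank_ker_mulVecLin_map_algebraMap] at h
  exact ⟨LinearEquiv.ofFinrankEq _ _ h⟩

end FractionField

section FixedVectors

open Matrix

variable {R n : Type*} [CommRing R] [Fintype n]

theorem mulVec_congr_of_support {m : Type*} {M : Matrix m n R} {p : n → Prop}
    (hM : ∀ i j, M i j ≠ 0 → p j) {x y : n → R} (hxy : ∀ j, p j → x j = y j) :
    M *ᵥ x = M *ᵥ y := by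
  refine funext fun i => Finset.sum_congr rfl fun j _ => ?_
  by_cases hij : M i j = 0
  · simp only [hij, zero_mul]
  · simp only [hxy j (hM i j hij)]

theorem toSquareBlockProp_mulVec (M : Matrix n n R) {p : n → Prop} [DecidablePred p]
    (hp : ∀ i j, p i → M i j ≠ 0 → p j) (x : n → R) :
    M.toSquareBlockProp p *ᵥ (x ∘ Subtype.val) = (M *ᵥ x) ∘ Subtype.val := by
  funext i
  calc ∑ j : {j // p j}, M i j * x j = ∑ j with p j, M i j * x j :=
        (Finset.sum_subtype _ (by simp) fun j => M i j * x j).symm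
    _ = ∑ j, M i j * x j :=
        Finset.sum_filter_of_ne fun j _ hj => hp i j i.2 (left_ne_zero_of_mul hj)

variable [DecidableEq n]

theorem mem_ker_mulVecLin_one_sub {M : Matrix n n R} {x : n → R} :
    x ∈ LinearMap.ker (1 - M).mulVecLin ↔ M *ᵥ x = x := by
  rw [LinearMap.mem_ker, mulVecLin_apply, sub_mulVec, one_mulVec, sub_eq_zero, eq_comm]

theorem pow_mulVec_eq_self {M : Matrix n n R} {x : n → R} (hx : M *ᵥ x = x) (k : ℕ) :
    M ^ k *ᵥ x = x := by
  induction k with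
  | zero => rw [pow_zero, one_mulVec]
  | succ k ih => rw [pow_succ, ← mulVec_mulVec, hx, ih]

variable {M : Matrix n n R} {p : n → Prop} [DecidablePred p]

theorem pow_mulVec_comp_val (hp : ∀ i j, p i → M i j ≠ 0 → p j) {y : {i // p i} → R}
    (hy : M.toSquareBlockProp p *ᵥ y = y) {z : n → R} (hz : z ∘ Subtype.val = y) (k : ℕ) :
    (M ^ k *ᵥ z) ∘ Subtype.val = y := by
  induction k with
  | zero => rw [pow_zero, one_mulVec, hz]
  | succ k ih => rw [pow_succ', ← mulVec_mulVec, ← toSquareBlockProp_mulVec M hp, ih, hy]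

/-- Restriction to the indices satisfying `p`, as a map from the fixed vectors of `M` to the fixed
vectors of the corresponding diagonal block. -/
def restrictFixed (hp : ∀ i j, p i → M i j ≠ 0 → p j) :
    LinearMap.ker (1 - M).mulVecLin →ₗ[R] LinearMap.ker (1 - M.toSquareBlockProp p).mulVecLin :=
  (LinearMap.funLeft R R Subtype.val).restrict fun x hx => by
    rw [mem_ker_mulVecLin_one_sub] at hx ⊢
    exact (toSquareBlockProp_mulVec M hp x).trans (by rw [hx]; rfl)

theorem restrictFixed_injective (hp : ∀ i j, p i → M i j ≠ 0 → p j) {L : ℕ}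
    (hL : ∀ i j, (M ^ L) i j ≠ 0 → p j) : Function.Injective (restrictFixed hp) := by
  intro x y hxy
  refine Subtype.ext ?_
  rw [← pow_mulVec_eq_self (mem_ker_mulVecLin_one_sub.1 x.2) L,
    ← pow_mulVec_eq_self (mem_ker_mulVecLin_one_sub.1 y.2) L]
  exact mulVec_congr_of_support hL fun i hi => congrFun (congrArg Subtype.val hxy) ⟨i, hi⟩

theorem restrictFixed_surjective (hp : ∀ i j, p i → M i j ≠ 0 → p j) {L : ℕ}
    (hL : ∀ i j, (M ^ L) i j ≠ 0 → p j) : Function.Surjective (restrictFixed hp) := by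
  intro y
  have hy := mem_ker_mulVecLin_one_sub.1 y.2
  obtain ⟨z, hz⟩ : ∃ z : n → R, z ∘ Subtype.val = y.1 :=
    Subtype.val_injective.surjective_comp_right y.1
  have hMz : (M *ᵥ z) ∘ Subtype.val = y.1 := by rw [← toSquareBlockProp_mulVec M hp, hz, hy]
  refine ⟨⟨M ^ L *ᵥ z, mem_ker_mulVecLin_one_sub.2 ?_⟩,
    Subtype.ext (pow_mulVec_comp_val hp hy hz L)⟩
  rw [mulVec_mulVec, ← pow_succ', pow_succ, ← mulVec_mulVec]
  exact mulVec_congr_of_support hL fun i hi => congrFun (hMz.trans hz.symm) ⟨i, hi⟩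

theorem finrank_ker_one_sub_toSquareBlockProp (hp : ∀ i j, p i → M i j ≠ 0 → p j) {L : ℕ}
    (hL : ∀ i j, (M ^ L) i j ≠ 0 → p j) :
    Module.finrank R (LinearMap.ker (1 - M.toSquareBlockProp p).mulVecLin) =
      Module.finrank R (LinearMap.ker (1 - M).mulVecLin) :=
  (LinearEquiv.ofBijective (restrictFixed hp)
    ⟨restrictFixed_injective hp hL, restrictFixed_surjective hp hL⟩).finrank_eq.symm

end FixedVectors

theorem finrank_quotient_range_eq_finrank_ker {K V : Type*} [DivisionRing K] [AddCommGroup V]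
    [Module K V] [FiniteDimensional K V] (f : V →ₗ[K] V) :
    Module.finrank K (V ⧸ LinearMap.range f) = Module.finrank K (LinearMap.ker f) := by
  have hquotient := (LinearMap.range f).finrank_quotient_add_finrank
  have hrank := f.finrank_range_add_finrank_ker
  omega

section MapMkQ

variable {R M W : Type*} [Ring R] [AddCommGroup M] [AddCommGroup W] [Module R M] [Module R W]
  {p q : Submodule R M}

theorem finrank_map_mkQ_of_surjective (f : p →ₗ[R] W) (hf : Function.Surjective f)
    (hq : ∀ x : p, f x = 0 ↔ x.1 ∈ q) :
    Module.finrank R (p.map q.mkQ) = Module.finrank R W := by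
  have hker : LinearMap.ker (q.mkQ.domRestrict p) = LinearMap.ker f := by
    ext x
    simp [hq]
  rw [← LinearMap.range_domRestrict, ← (LinearMap.quotKerEquivRange _).finrank_eq, hker,
    (f.quotKerEquivOfSurjective hf).finrank_eq]

theorem finrank_map_mkQ_congr {M' : Type*} [AddCommGroup M'] [Module R M'] (f : M ≃ₗ[R] M')
    {p' q' : Submodule R M'} (hp : ∀ x, f x ∈ p' ↔ x ∈ p) (hq : ∀ x, f x ∈ q' ↔ x ∈ q) :
    Module.finrank R (p.map q.mkQ) = Module.finrank R (p'.map q'.mkQ) := by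
  have hpp' : p.map (f : M →ₗ[R] M') = p' := by
    ext y
    obtain ⟨x, rfl⟩ := f.surjective y
    simp [hp]
  let g : p →ₗ[R] p'.map q'.mkQ := (q'.mkQ.submoduleMap p') ∘ₗ
    (LinearEquiv.ofSubmodules f p p' hpp' : p →ₗ[R] p')
  refine finrank_map_mkQ_of_surjective g ?_ fun x => ?_
  · exact (q'.mkQ.submoduleMap_surjective p').comp
      (LinearEquiv.ofSubmodules f p p' hpp').surjective
  · rw [← hq, ← Submodule.Quotient.mk_eq_zero q']
    exact Subtype.ext_iff

end MapMkQ

theorem injOn_image_iff_of_semiconj {X Y : Type*} {f : X → Y} (hf : Function.Injective f)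
    {a : X → X} {b : Y → Y} (h : Function.Semiconj f a b) {U : Set X} :
    (f '' U).InjOn b ↔ U.InjOn a := by
  constructor
  · intro hb x hx y hy hxy
    exact hf (hb ⟨x, hx, rfl⟩ ⟨y, hy, rfl⟩ (by rw [← h x, ← h y, hxy]))
  · rintro ha _ ⟨x, hx, rfl⟩ _ ⟨y, hy, rfl⟩ hxy
    rw [← h x, ← h y] at hxy
    rw [ha hx hy (hf hxy)]

namespace ArrowGroupoid

section MulSet

variable {G : Type*} [ArrowGroupoid G] {U U' V V' : Set G}

/-- The product of two sets of arrows: all products of composable arrows from `U` and `V`. -/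
def mulSet (U V : Set G) : Set G :=
  {k | ∃ g ∈ U, ∃ h ∈ V, ∃ c : src g = rng h, k = mul g h c}

theorem mulSet_mono (hU : U ⊆ U') (hV : V ⊆ V') : mulSet U V ⊆ mulSet U' V' := by
  rintro _ ⟨g, hg, h, hh, c, rfl⟩
  exact ⟨g, hU hg, h, hV hh, c, rfl⟩

theorem image_src_mulSet (hUV : rng '' V ⊆ src '' U) : src '' mulSet U V = src '' V := by
  ext x
  constructor
  · rintro ⟨_, ⟨g, -, h, hh, c, rfl⟩, rfl⟩
    exact ⟨h, hh, (src_mul g h c).symm⟩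
  · rintro ⟨h, hh, rfl⟩
    obtain ⟨g, hg, c⟩ := hUV ⟨h, hh, rfl⟩
    exact ⟨mul g h c, ⟨g, hg, h, hh, c, rfl⟩, src_mul g h c⟩

theorem injOn_src_mulSet (hU : U.InjOn src) (hV : V.InjOn src) : (mulSet U V).InjOn src := by
  rintro _ ⟨g, hg, h, hh, c, rfl⟩ _ ⟨g', hg', h', hh', c', rfl⟩ e
  rw [src_mul, src_mul] at e
  obtain rfl := hV hh hh' e
  obtain rfl := hU hg hg' (c.trans c'.symm)
  rfl

variable {ι : Type*} {C D : ι → Set G} {F : Finset ι}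

theorem isDecomposition_left_of_image_eq (hU : U.InjOn src) (hV : V.InjOn rng)
    (hUV : src '' U = rng '' V) (hD : IsDecomposition D F V) (hC : ∀ i ∈ F, C i ⊆ U)
    (hCD : ∀ i ∈ F, src '' C i = rng '' D i) : IsDecomposition C F U := by
  refine .of_image hU hC ?_
  rw [hUV]
  exact (hD.image hV).congr fun i hi => (hCD i hi).symm

theorem isDecomposition_mulSet (hU : U.InjOn src) (hV : V.InjOn src) (hUV : src '' U = rng '' V)
    (hD : IsDecomposition D F V) (hC : ∀ i ∈ F, C i ⊆ U) (hCD : ∀ i ∈ F, src '' C i = rng '' D i) :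
    IsDecomposition (fun i => mulSet (C i) (D i)) F (mulSet U V) := by
  refine .of_image (injOn_src_mulSet hU hV)
    (fun i hi => mulSet_mono (hC i hi) (hD.subset hi)) ?_
  rw [image_src_mulSet hUV.ge]
  exact (hD.image hV).congr fun i hi => (image_src_mulSet (hCD i hi).ge).symm

theorem eq_src_of_mul_eq_left {g h : G} (c : src g = rng h) (e : mul g h c = g) : h = src g := by
  have hassoc := mul_assoc (inv g) g h (src_inv g) c
  have hcongr {a b : G} (ab : a = b) {a' b' : G} (ab' : a' = b') (ca : src a = rng a')
      (cb : src b = rng b') : mul a a' ca = mul b b' cb := by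
    subst ab ab'
    rfl
  rw [hcongr ((inv_mul g).trans c) rfl _ (src_rng h), rng_mul_self,
    hcongr rfl e _ (src_inv g), inv_mul] at hassoc
  exact hassoc

end MulSet

section Invariants

/-- Compact open bisections: compact open sets of arrows on which source and range are
injective. -/
structure IsCompactOpenBisection {G : Type*} [ArrowGroupoid G] [TopologicalSpace G]
    (U : Set G) : Prop where
  isCompact : IsCompact U
  isOpen : IsOpen U
  injOn_src : U.InjOn src
  injOn_rng : U.InjOn rng

variable (𝕜 : Type*) [Field 𝕜] (G : Type*) [ArrowGroupoid G] [TopologicalSpace G]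

/-- The functionals which are additive on products of matching compact open bisections. Only the
values on indicators of compact open bisections matter, and on these a cocycle is a homomorphism
from the first homology group of an ample groupoid to `𝕜`. -/
def cocycles : Submodule 𝕜 ((G → 𝕜) →ₗ[𝕜] 𝕜) where
  carrier := {l | ∀ U : Set G, IsCompactOpenBisection U → ∀ V : Set G, IsCompactOpenBisection V →
    src '' U = rng '' V →
      l ((mulSet U V).indicator 1) = l (U.indicator 1) + l (V.indicator 1)}
  zero_mem' U _ V _ _ := (add_zero 0).symm
  add_mem' hl hl' U hU V hV hUV := by
    simp only [LinearMap.add_apply, hl U hU V hV hUV, hl' U hU V hV hUV, add_add_add_comm]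
  smul_mem' c l hl U hU V hV hUV := by
    simp only [LinearMap.smul_apply, hl U hU V hV hUV, smul_add]

/-- The functionals which on compact open bisections are the difference of the values of another
functional at the source and at the range. -/
def coboundaries : Submodule 𝕜 ((G → 𝕜) →ₗ[𝕜] 𝕜) where
  carrier := {l | ∃ k : (G → 𝕜) →ₗ[𝕜] 𝕜, ∀ U : Set G, IsCompactOpenBisection U →
    l (U.indicator 1) = k ((src '' U).indicator 1) - k ((rng '' U).indicator 1)}
  zero_mem' := ⟨0, fun U _ => (sub_zero 0).symm⟩
  add_mem' := fun ⟨k, hk⟩ ⟨k', hk'⟩ => ⟨k + k', fun U hU => by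
    simp only [LinearMap.add_apply, hk U hU, hk' U hU, add_sub_add_comm]⟩
  smul_mem' c _ := fun ⟨k, hk⟩ => ⟨c • k, fun U hU => by
    simp only [LinearMap.smul_apply, hk U hU, smul_sub]⟩

/-- The functionals which agree on the source and the range of each compact open bisection:
invariant finitely additive measures on the unit space, up to `nullFunctionals`. -/
def invariants : Submodule 𝕜 ((G → 𝕜) →ₗ[𝕜] 𝕜) where
  carrier := {l | ∀ U : Set G, IsCompactOpenBisection U →
    l ((src '' U).indicator 1) = l ((rng '' U).indicator 1)}
  zero_mem' U _ := rfl
  add_mem' hl hl' U hU := by simp only [LinearMap.add_apply, hl U hU, hl' U hU]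
  smul_mem' c l hl U hU := by simp only [LinearMap.smul_apply, hl U hU]

/-- The functionals which vanish on the sources of compact open bisections, that is, those which
are zero as finitely additive measures on the unit space. -/
def nullFunctionals : Submodule 𝕜 ((G → 𝕜) →ₗ[𝕜] 𝕜) where
  carrier := {l | ∀ U : Set G, IsCompactOpenBisection U → l ((src '' U).indicator 1) = 0}
  zero_mem' U _ := rfl
  add_mem' hl hl' U hU := by simp only [LinearMap.add_apply, hl U hU, hl' U hU, add_zero]
  smul_mem' c l hl U hU := by simp only [LinearMap.smul_apply, hl U hU, smul_zero]

/-- The dimension of the space of `𝕜`-valued invariant finitely additive measures on the unit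
space. -/
noncomputable def invariantDim : ℕ :=
  Module.finrank 𝕜 ((invariants 𝕜 G).map (nullFunctionals 𝕜 G).mkQ)

/-- The dimension of the space of `𝕜`-valued cocycles modulo coboundaries. -/
noncomputable def cocycleDim : ℕ :=
  Module.finrank 𝕜 ((cocycles 𝕜 G).map (coboundaries 𝕜 G).mkQ)

end Invariants

namespace TopIso

variable {G H : Type*} [ArrowGroupoid G] [ArrowGroupoid H] [TopologicalSpace G]
  [TopologicalSpace H] (e : TopIso G H)

theorem semiconj_src : Function.Semiconj e.toHomeomorph src src := fun g =>
  eq_src_of_mul_eq_left ((e.composable_iff _ _).1 (rng_src g).symm)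
    ((e.map_mul _ _ (rng_src g).symm).symm.trans (congrArg e.toHomeomorph (mul_src g)))

theorem semiconj_rng : Function.Semiconj e.toHomeomorph rng rng := fun g => by
  have h : src (e.toHomeomorph (rng g)) = rng (e.toHomeomorph g) :=
    (e.composable_iff _ _).1 (src_rng g)
  rw [← h, ← e.semiconj_src (rng g), src_rng]

theorem image_mulSet (U V : Set G) :
    e.toHomeomorph '' mulSet U V = mulSet (e.toHomeomorph '' U) (e.toHomeomorph '' V) := by
  ext k
  constructor
  · rintro ⟨_, ⟨g, hg, h, hh, c, rfl⟩, rfl⟩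
    exact ⟨_, ⟨g, hg, rfl⟩, _, ⟨h, hh, rfl⟩, (e.composable_iff g h).1 c, e.map_mul g h c⟩
  · rintro ⟨_, ⟨g, hg, rfl⟩, _, ⟨h, hh, rfl⟩, c, rfl⟩
    have c' := (e.composable_iff g h).2 c
    exact ⟨_, ⟨g, hg, h, hh, c', rfl⟩, e.map_mul g h c'⟩

theorem isCompactOpenBisection_image {U : Set G} :
    IsCompactOpenBisection (e.toHomeomorph '' U) ↔ IsCompactOpenBisection U := by
  have hsrc := injOn_image_iff_of_semiconj e.toHomeomorph.injective e.semiconj_src (U := U)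
  have hrng := injOn_image_iff_of_semiconj e.toHomeomorph.injective e.semiconj_rng (U := U)
  exact ⟨fun h => ⟨e.toHomeomorph.isCompact_image.1 h.1, e.toHomeomorph.isOpen_image.1 h.2,
      hsrc.1 h.3, hrng.1 h.4⟩,
    fun h => ⟨e.toHomeomorph.isCompact_image.2 h.1, e.toHomeomorph.isOpen_image.2 h.2,
      hsrc.2 h.3, hrng.2 h.4⟩⟩

theorem forall_isCompactOpenBisection {p : Set H → Prop} :
    (∀ U, IsCompactOpenBisection U → p U) ↔
      ∀ U : Set G, IsCompactOpenBisection U → p (e.toHomeomorph '' U) := by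
  refine (Set.image_surjective.2 e.toHomeomorph.surjective).forall.trans ?_
  exact forall_congr' fun U => imp_congr_left e.isCompactOpenBisection_image

variable (𝕜 : Type*) [Field 𝕜]

/-- The transport of functionals along an isomorphism of topological groupoids. -/
def dualEquiv : ((G → 𝕜) →ₗ[𝕜] 𝕜) ≃ₗ[𝕜] ((H → 𝕜) →ₗ[𝕜] 𝕜) :=
  (LinearEquiv.funCongrLeft 𝕜 𝕜 e.toHomeomorph.toEquiv).dualMap

variable {𝕜}

theorem dualEquiv_indicator (l : (G → 𝕜) →ₗ[𝕜] 𝕜) (U : Set G) :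
    e.dualEquiv 𝕜 l ((e.toHomeomorph '' U).indicator 1) = l (U.indicator 1) := by
  refine congrArg l (funext fun g => ?_)
  classical
  exact if_congr (e.toHomeomorph.injective.mem_set_image) rfl rfl

theorem dualEquiv_mem_cocycles (l : (G → 𝕜) →ₗ[𝕜] 𝕜) :
    e.dualEquiv 𝕜 l ∈ cocycles 𝕜 H ↔ l ∈ cocycles 𝕜 G := by
  refine e.forall_isCompactOpenBisection.trans (forall₂_congr fun U _ => ?_)
  refine e.forall_isCompactOpenBisection.trans (forall₂_congr fun V _ => ?_)
  rw [← e.semiconj_src.set_image U, ← e.semiconj_rng.set_image V,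
    (Set.image_injective.2 e.toHomeomorph.injective).eq_iff, ← e.image_mulSet]
  simp only [e.dualEquiv_indicator]

theorem dualEquiv_mem_coboundaries (l : (G → 𝕜) →ₗ[𝕜] 𝕜) :
    e.dualEquiv 𝕜 l ∈ coboundaries 𝕜 H ↔ l ∈ coboundaries 𝕜 G := by
  refine (e.dualEquiv 𝕜).surjective.exists.trans (exists_congr fun k => ?_)
  refine e.forall_isCompactOpenBisection.trans (forall₂_congr fun U _ => ?_)
  simp only [← e.semiconj_src.set_image U, ← e.semiconj_rng.set_image U, e.dualEquiv_indicator]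

theorem dualEquiv_mem_invariants (l : (G → 𝕜) →ₗ[𝕜] 𝕜) :
    e.dualEquiv 𝕜 l ∈ invariants 𝕜 H ↔ l ∈ invariants 𝕜 G := by
  refine e.forall_isCompactOpenBisection.trans (forall₂_congr fun U _ => ?_)
  simp only [← e.semiconj_src.set_image U, ← e.semiconj_rng.set_image U, e.dualEquiv_indicator]

theorem dualEquiv_mem_nullFunctionals (l : (G → 𝕜) →ₗ[𝕜] 𝕜) :
    e.dualEquiv 𝕜 l ∈ nullFunctionals 𝕜 H ↔ l ∈ nullFunctionals 𝕜 G := by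
  refine e.forall_isCompactOpenBisection.trans (forall₂_congr fun U _ => ?_)
  simp only [← e.semiconj_src.set_image U, e.dualEquiv_indicator]

end TopIso

section

variable (𝕜 : Type*) [Field 𝕜] {G H : Type*} [ArrowGroupoid G] [ArrowGroupoid H]
  [TopologicalSpace G] [TopologicalSpace H]

theorem invariantDim_eq_of_topIso (e : TopIso G H) : invariantDim 𝕜 G = invariantDim 𝕜 H :=
  finrank_map_mkQ_congr (e.dualEquiv 𝕜) e.dualEquiv_mem_invariants e.dualEquiv_mem_nullFunctionals

theorem cocycleDim_eq_of_topIso (e : TopIso G H) : cocycleDim 𝕜 G = cocycleDim 𝕜 H :=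
  finrank_map_mkQ_congr (e.dualEquiv 𝕜) e.dualEquiv_mem_cocycles e.dualEquiv_mem_coboundaries

end

end ArrowGroupoid

namespace Katsura

variable {N : ℕ} {A B : Matrix (Fin N) (Fin N) ℤ}

section Edges

instance : DiscreteTopology (Edge A) := ⟨rfl⟩

instance : Finite (Edge A) := by
  let f : Edge A → Σ i : Fin N, Σ j : Fin N, Finset.Ico 0 (A i j) :=
    fun e => ⟨e.src, e.tgt, e.idx, Finset.mem_Ico.2 ⟨e.idx_nonneg, e.idx_lt⟩⟩
  refine Finite.of_injective f ?_
  rintro ⟨i, j, n, h0, h1⟩ ⟨i', j', n', h0', h1'⟩ h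
  simp only [f, Sigma.mk.injEq] at h
  obtain ⟨rfl, h⟩ := h
  rw [heq_eq_eq, Sigma.mk.injEq] at h
  obtain ⟨rfl, h⟩ := h
  rw [heq_eq_eq, Subtype.mk.injEq] at h
  subst h
  rfl

/-- The edges with source `v`. -/
abbrev OutEdge (A : Matrix (Fin N) (Fin N) ℤ) (v : Fin N) : Type := {e : Edge A // v = e.src}

noncomputable instance (v : Fin N) : Fintype (OutEdge A v) := Fintype.ofFinite _

theorem card_outEdge_filter_tgt (hA : ∀ i j, 0 ≤ A i j) (v w : Fin N) :
    (Finset.card {e : OutEdge A v | e.1.tgt = w} : ℤ) = A v w := by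
  have hbij : Finset.card {e : OutEdge A v | e.1.tgt = w} = (Finset.Ico 0 (A v w)).card := by
    refine Finset.card_bij (fun e _ => e.1.idx) ?_ ?_ ?_
    · rintro ⟨e, rfl⟩ he
      obtain rfl : e.tgt = w := (Finset.mem_filter.1 he).2
      exact Finset.mem_Ico.2 ⟨e.idx_nonneg, e.idx_lt⟩
    · rintro ⟨e, he⟩ hw ⟨e', he'⟩ hw' h
      exact Subtype.ext (Edge.ext (he.symm.trans he')
        ((Finset.mem_filter.1 hw).2.trans (Finset.mem_filter.1 hw').2.symm) h)
    · intro n hn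
      obtain ⟨h0, h1⟩ := Finset.mem_Ico.1 hn
      exact ⟨⟨⟨v, w, n, h0, h1⟩, rfl⟩, by simp, rfl⟩
  rw [hbij, Int.card_Ico, sub_zero, Int.toNat_of_nonneg (hA v w)]

theorem sum_outEdge_smul {M : Type*} [AddCommGroup M] {v : Fin N} (c : OutEdge A v → ℤ)
    (f : Fin N → M) :
    ∑ e, c e • f e.1.tgt = ∑ w, (∑ e with e.1.tgt = w, c e) • f w := by
  simp_rw [Finset.sum_smul]
  rw [← Finset.sum_fiberwise Finset.univ fun e : OutEdge A v => e.1.tgt]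
  refine Finset.sum_congr rfl fun w _ => Finset.sum_congr rfl fun e he => ?_
  rw [(Finset.mem_filter.1 he).2]

theorem sum_outEdge_tgt {M : Type*} [AddCommGroup M] (hA : ∀ i j, 0 ≤ A i j) (v : Fin N)
    (f : Fin N → M) : ∑ e : OutEdge A v, f e.1.tgt = ∑ w, A v w • f w := by
  simpa [card_outEdge_filter_tgt hA] using sum_outEdge_smul (fun _ : OutEdge A v => 1) f

theorem act_neg_act (m : ℤ) (e : Edge A) : act B (-m) (act B m e) = e := by
  rw [← (act_coc_add B _ _ _).1, neg_add_cancel, (act_coc_zero B _).1]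

theorem act_act_neg (m : ℤ) (e : Edge A) : act B m (act B (-m) e) = e := by
  rw [← (act_coc_add B _ _ _).1, add_neg_cancel, (act_coc_zero B _).1]

variable (B) in
/-- The permutation `κ_m` of the edges with source `v`. -/
def outEdgeAct (v : Fin N) (m : ℤ) : Equiv.Perm (OutEdge A v) where
  toFun e := ⟨act B m e.1, e.2⟩
  invFun e := ⟨act B (-m) e.1, e.2⟩
  left_inv e := Subtype.ext (act_neg_act m e.1)
  right_inv e := Subtype.ext (act_act_neg m e.1)

theorem sum_coc_filter_tgt (hA : ∀ i j, 0 ≤ A i j) (hsupp : ∀ i j, A i j = 0 → B i j = 0)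
    (v w : Fin N) (m : ℤ) :
    ∑ e : OutEdge A v with e.1.tgt = w, coc B m e.1 = m * B v w := by
  by_cases h : A v w = 0
  · have hcard := card_outEdge_filter_tgt hA v w
    rw [h, Nat.cast_eq_zero, Finset.card_eq_zero] at hcard
    rw [hcard, hsupp v w h, Finset.sum_empty, mul_zero]
  -- `κ_m` permutes the edges from `v` to `w`, so the indices cancel in the sum of `coc_mul_add`.
  have hperm : ∑ e : OutEdge A v with e.1.tgt = w, (act B m e.1).idx =
      ∑ e : OutEdge A v with e.1.tgt = w, e.1.idx :=
    Finset.sum_equiv (outEdgeAct B v m) (by simp [outEdgeAct]) fun _ _ => rfl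
  have hsum : ∑ e : OutEdge A v with e.1.tgt = w, (coc B m e.1 * A v w + (act B m e.1).idx) =
      ∑ e : OutEdge A v with e.1.tgt = w, (m * B v w + e.1.idx) := by
    refine Finset.sum_congr rfl ?_
    rintro ⟨e, rfl⟩ he
    obtain rfl : e.tgt = w := (Finset.mem_filter.1 he).2
    exact coc_mul_add B m e
  rw [Finset.sum_add_distrib, Finset.sum_add_distrib, hperm, add_left_inj, ← Finset.sum_mul,
    Finset.sum_const, nsmul_eq_mul, card_outEdge_filter_tgt hA, mul_comm] at hsum
  exact mul_left_cancel₀ h hsum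

theorem sum_coc_smul_tgt {M : Type*} [AddCommGroup M] (hA : ∀ i j, 0 ≤ A i j)
    (hsupp : ∀ i j, A i j = 0 → B i j = 0) (v : Fin N) (m : ℤ) (f : Fin N → M) :
    ∑ e : OutEdge A v, coc B m e.1 • f e.1.tgt = m • ∑ w, B v w • f w := by
  rw [sum_outEdge_smul]
  simp_rw [sum_coc_filter_tgt hA hsupp, Finset.smul_sum, mul_smul]

end Edges

section Paths

/-- Every vertex emits an edge. -/
def NoSinks (A : Matrix (Fin N) (Fin N) ℤ) : Prop := ∀ v, ∃ e : Edge A, e.src = v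

theorem noSinks_of_rows_ne_zero (hA : ∀ i j, 0 ≤ A i j) (hrow : ∀ i, ∃ j, A i j ≠ 0) :
    NoSinks A := fun v => by
  obtain ⟨j, hj⟩ := hrow v
  exact ⟨⟨v, j, 0, le_rfl, (hA v j).lt_of_ne hj.symm⟩, rfl⟩

theorem NoSinks.exists_infPath (h : NoSinks A) (v : Fin N) : ∃ y : InfPath A, v = y.start := by
  choose γ hγ using h
  refine ⟨⟨fun n => γ ((fun i => (γ i).tgt)^[n] v), fun n => ?_⟩, (hγ v).symm⟩
  rw [hγ, Function.iterate_succ_apply']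

namespace InfPath

/-- The infinite path `e y`. -/
def cons (e : Edge A) (y : InfPath A) (h : e.tgt = y.start) : InfPath A :=
  ⟨fun n => Nat.casesOn n e y.1, fun n => by cases n with
    | zero => exact h
    | succ n => exact y.2 n⟩

/-- The infinite path without its first `n` edges. -/
def drop (n : ℕ) (y : InfPath A) : InfPath A := ⟨fun i => y.1 (n + i), fun i => y.2 (n + i)⟩

/-- The two paths have the same first `n` edges. -/
def Agree (n : ℕ) (x y : InfPath A) : Prop := ∀ i < n, x.1 i = y.1 i

theorem Agree.symm {n : ℕ} {x y : InfPath A} (h : Agree n x y) : Agree n y x :=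
  fun i hi => (h i hi).symm

theorem Agree.trans {n : ℕ} {x y z : InfPath A} (h : Agree n x y) (h' : Agree n y z) :
    Agree n x z :=
  fun i hi => (h i hi).trans (h' i hi)

theorem Agree.mono {n k : ℕ} {x y : InfPath A} (h : Agree n x y) (hk : k ≤ n) : Agree k x y :=
  fun i hi => h i (hi.trans_le hk)

theorem isOpen_iff {U : Set (InfPath A)} :
    IsOpen U ↔ ∀ x ∈ U, ∃ n, ∀ z, Agree n z x → z ∈ U := by
  have hind : Topology.IsInducing (fun x : InfPath A => x.1) := ⟨rfl⟩
  rw [((PiNat.isTopologicalBasis_cylinders fun _ => Edge A).isInducing hind).isOpen_iff]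
  refine forall₂_congr fun x _ => ⟨?_, ?_⟩
  · rintro ⟨_, ⟨_, ⟨y, n, rfl⟩, rfl⟩, hx, hU⟩
    exact ⟨n, fun z hz => hU fun i hi => (hz i hi).trans (hx i hi)⟩
  · rintro ⟨n, hn⟩
    exact ⟨_, ⟨_, ⟨x.1, n, rfl⟩, rfl⟩, fun i _ => rfl, hn⟩

instance : CompactSpace (InfPath A) := by
  have hclosed : IsClosed {x : ℕ → Edge A | ∀ n, (x n).tgt = (x (n + 1)).src} := by
    rw [Set.ofPred_forall]
    refine isClosed_iInter fun n => isClosed_eq ?_ ?_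
    · exact (continuous_of_discreteTopology (f := Edge.tgt (A := A))).comp (continuous_apply n)
    · exact (continuous_of_discreteTopology (f := Edge.src (A := A))).comp
        (continuous_apply (n + 1))
  exact isCompact_iff_compactSpace.1 hclosed.isCompact

end InfPath

theorem prepend_apply_of_lt {X : Type*} (l : List X) (y y' : ℕ → X) {i : ℕ}
    (hi : i < l.length) : prepend l y i = prepend l y' i := by
  induction l generalizing i with
  | nil => simp at hi
  | cons e l ih =>
    cases i with
    | zero => rfl
    | succ i => exact ih (by simpa using hi)

theorem prepend_apply_length_add {X : Type*} (l : List X) (y : ℕ → X) (i : ℕ) :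
    prepend l y (l.length + i) = y i := by
  induction l with
  | nil => exact congrArg y (Nat.zero_add i)
  | cons e l ih =>
    rw [List.length_cons, Nat.add_right_comm]
    exact ih

namespace FinPath

open InfPath

theorem agree_of_mem_cylinder {β : FinPath A} {x z : InfPath A} (hx : x ∈ β.cylinder)
    (hz : z ∈ β.cylinder) : Agree β.edges.length x z := by
  obtain ⟨y, _, rfl⟩ := hx
  obtain ⟨y', _, rfl⟩ := hz
  exact fun i hi => prepend_apply_of_lt _ _ _ hi

-- One edge more than the length of `β` is needed: a path of length zero records a vertex.
theorem mem_cylinder_of_agree {β : FinPath A} {x z : InfPath A} (hx : x ∈ β.cylinder)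
    (h : Agree (β.edges.length + 1) z x) : z ∈ β.cylinder := by
  obtain ⟨y, hy, rfl⟩ := hx
  refine ⟨z.drop β.edges.length, ?_, Subtype.ext (funext fun i => ?_)⟩
  · change _ = (z.1 (β.edges.length + 0)).src
    rw [h _ (by omega), hy]
    exact congrArg Edge.src (prepend_apply_length_add β.edges y.1 0).symm
  · change _ = prepend β.edges (z.drop β.edges.length).1 i
    by_cases hi : i < β.edges.length
    · exact (h i (by omega)).trans (prepend_apply_of_lt _ _ _ hi)
    · obtain ⟨k, rfl⟩ := Nat.exists_eq_add_of_le (not_lt.1 hi)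
      exact (prepend_apply_length_add β.edges (z.drop β.edges.length).1 k).symm

theorem isOpen_cylinder (β : FinPath A) : IsOpen β.cylinder :=
  InfPath.isOpen_iff.2 fun _ hx => ⟨_, fun _ hz => mem_cylinder_of_agree hx hz⟩

theorem isClosed_cylinder (β : FinPath A) : IsClosed β.cylinder :=
  ⟨InfPath.isOpen_iff.2 fun _ hx =>
    ⟨β.edges.length + 1, fun _ hz h => hx (mem_cylinder_of_agree h hz.symm)⟩⟩

theorem cylinder_snoc_subset (β : FinPath A) (e : Edge A) (h : β.tgt = e.src) :
    (β.snoc e h).cylinder ⊆ β.cylinder := by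
  rintro _ ⟨y, hy, rfl⟩
  exact ⟨y.cons e hy, h, append_snoc β (y.cons e hy) h⟩

end FinPath

end Paths

end Katsura

namespace Katsura

open ArrowGroupoid Filter

variable {N : ℕ} {A B : Matrix (Fin N) (Fin N) ℤ}

section Quadruples

namespace Quad

/-- The relation between quadruples `(α, m, β; x)` and `(α, m, β; x')` that differ only in the
infinite path. -/
def SameTriple (p q : Quad A) : Prop := p.α = q.α ∧ p.m = q.m ∧ p.β = q.β

theorem SameTriple.exists_step_eq {p q : Quad A} (h : SameTriple p (q.step B)) :
    ∃ p', SameTriple p' q ∧ p'.step B = p := by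
  obtain ⟨hα, hm, hβ⟩ := h
  have htgt : (q.y.1 0).tgt = p.y.start := by rw [← p.hβ, hβ]; rfl
  exact ⟨⟨q.α, q.m, q.β, p.y.cons (q.y.1 0) htgt, q.hα, q.hβ⟩, ⟨rfl, rfl, rfl⟩,
    ext_of hα.symm hm.symm hβ.symm rfl⟩

theorem SameTriple.exists_iterate_step_eq {p q : Quad A} {n : ℕ}
    (h : SameTriple p ((step B)^[n] q)) : ∃ p', SameTriple p' q ∧ (step B)^[n] p' = p := by
  induction n generalizing p with
  | zero => exact ⟨p, h, rfl⟩
  | succ n ih =>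
    rw [Function.iterate_succ_apply'] at h
    obtain ⟨p', hp', rfl⟩ := h.exists_step_eq
    obtain ⟨p'', hp'', rfl⟩ := ih hp'
    exact ⟨p'', hp'', Function.iterate_succ_apply' _ _ _⟩

theorem SameTriple.step {p q : Quad A} (h : SameTriple p q) (h0 : p.y.1 0 = q.y.1 0) :
    SameTriple (p.step B) (q.step B) := by
  obtain ⟨hα, hm, hβ⟩ := h
  refine ⟨FinPath.ext_of (congrArg FinPath.src hα :) ?_, ?_,
    FinPath.ext_of (congrArg FinPath.src hβ :) ?_⟩
  · change p.α.edges ++ [act B p.m (p.y.1 0)] = q.α.edges ++ [act B q.m (q.y.1 0)]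
    rw [hα, hm, h0]
  · change coc B p.m (p.y.1 0) = coc B q.m (q.y.1 0)
    rw [hm, h0]
  · change p.β.edges ++ [p.y.1 0] = q.β.edges ++ [q.y.1 0]
    rw [hβ, h0]

theorem SameTriple.iterate_step {p q : Quad A} (h : SameTriple p q) {n : ℕ}
    (hy : InfPath.Agree n p.y q.y) : SameTriple ((Quad.step B)^[n] p) ((Quad.step B)^[n] q) := by
  induction n generalizing p q with
  | zero => exact h
  | succ n ih =>
    rw [Function.iterate_succ_apply, Function.iterate_succ_apply]
    exact ih (h.step (hy 0 n.succ_pos)) fun i hi => hy (i + 1) (Nat.succ_lt_succ hi)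

theorem pt_mem_cylinder (q : Quad A) : q.pt ∈ q.β.cylinder := ⟨q.y, q.hβ, rfl⟩

theorem im_mem_cylinder (q : Quad A) : q.im B ∈ q.α.cylinder := ⟨q.y.act B q.m, q.hα, rfl⟩

theorem pt_iterate_step (n : ℕ) (q : Quad A) : ((step B)^[n] q).pt = q.pt :=
  congrArg KEP.s (KEP.mk_iterate n q : (KEP.mk _ : KEP A B) = _)

theorem im_iterate_step (n : ℕ) (q : Quad A) : ((step B)^[n] q).im B = q.im B :=
  congrArg KEP.r (KEP.mk_iterate n q : (KEP.mk _ : KEP A B) = _)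

-- Pseudo-freeness recovers `m` from `e`, `κ_m(e)` and `φ(m, e)`.
theorem step_injective (hpf : PseudoFree A B) :
    Function.Injective (step B : Quad A → Quad A) := by
  intro p q h
  obtain ⟨hβ, he⟩ : p.β = q.β ∧ p.y.1 0 = q.y.1 0 :=
    FinPath.snoc_inj (hα := p.hβ) (hβ := q.hβ) (congrArg Quad.β h)
  obtain ⟨hα, hact⟩ : p.α = q.α ∧ act B p.m (p.y.1 0) = act B q.m (q.y.1 0) :=
    FinPath.snoc_inj (hα := p.hα) (hβ := q.hα) (congrArg Quad.α h)
  have hcoc : coc B p.m (p.y.1 0) = coc B q.m (q.y.1 0) := congrArg Quad.m h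
  have hadd := act_coc_add B (p.m - q.m) q.m (q.y.1 0)
  rw [sub_add_cancel, ← he, hcoc, hact, ← he] at hadd
  have hm : p.m - q.m = 0 := hpf _ _ hadd.1.symm (by linarith [hadd.2])
  exact ext_of hα (sub_eq_zero.1 hm) hβ (InfPath.ext_of he (congrArg Quad.y h :))

end Quad

namespace KEP

theorem exists_iterate_step_eq {p q : Quad A} (h : (mk p : KEP A B) = mk q) :
    ∃ a b, (Quad.step B)^[a] p = (Quad.step B)^[b] q := by
  induction Quot.eqvGen_exact h with
  | rel p q e => exact ⟨1, 0, e.symm⟩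
  | refl p => exact ⟨0, 0, rfl⟩
  | symm p q _ ih =>
    obtain ⟨a, b, e⟩ := ih h.symm
    exact ⟨b, a, e.symm⟩
  | trans p q t hpq hqt ih ih' =>
    obtain ⟨a, b, hab⟩ := ih (Quot.eqvGen_sound hpq)
    obtain ⟨c, d, hcd⟩ := ih' (Quot.eqvGen_sound hqt)
    refine ⟨c + a, b + d, ?_⟩
    rw [Function.iterate_add_apply, hab, ← Function.iterate_add_apply, add_comm c b,
      Function.iterate_add_apply, hcd, ← Function.iterate_add_apply]

theorem eq_of_mk_eq_mk (hpf : PseudoFree A B) {p q : Quad A}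
    (hl : p.β.edges.length = q.β.edges.length) (h : (mk p : KEP A B) = mk q) : p = q := by
  obtain ⟨a, b, hab⟩ := exists_iterate_step_eq h
  have hlen := congrArg (fun q : Quad A => q.β.edges.length) hab
  simp only [(length_iterate _ _).2] at hlen
  obtain rfl : a = b := by omega
  exact (Quad.step_injective hpf).iterate a hab

theorem eventually_sameTriple_mk_mem_basicSet {α β : FinPath A} {m : ℤ} {U : Set (InfPath A)}
    (hU : IsOpen U) {q : Quad A} (hq : (mk q : KEP A B) ∈ basicSet α m β U) :
    ∀ᶠ n in atTop, ∀ p, Quad.SameTriple p ((Quad.step B)^[n] q) →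
      (mk p : KEP A B) ∈ basicSet α m β U := by
  obtain ⟨q₀, rfl, rfl, rfl, hq₀U, hqq₀⟩ := hq
  obtain ⟨a, b, hab⟩ := exists_iterate_step_eq hqq₀
  obtain ⟨k, hk⟩ := InfPath.isOpen_iff.1 hU _ hq₀U
  filter_upwards [eventually_ge_atTop (k + a)] with n hn p hp
  obtain ⟨i, rfl⟩ := Nat.exists_eq_add_of_le hn
  rw [add_right_comm, Function.iterate_add_apply, hab, ← Function.iterate_add_apply] at hp
  obtain ⟨p₀, ⟨hα, hm, hβ⟩, rfl⟩ := hp.exists_iterate_step_eq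
  refine ⟨p₀, hα, hm, hβ, hk _ ?_, mk_iterate _ _⟩
  have hmem := hp.2.2 ▸ Quad.pt_mem_cylinder ((Quad.step B)^[k + i + b] p₀)
  have hagree := FinPath.agree_of_mem_cylinder hmem (Quad.pt_mem_cylinder _)
  rw [Quad.pt_iterate_step, Quad.pt_iterate_step, (length_iterate _ _).2] at hagree
  exact hagree.mono (by omega)

theorem eventually_sameTriple_mk_mem {O : Set (KEP A B)} (hO : IsOpen O) {q : Quad A}
    (hq : mk q ∈ O) :
    ∀ᶠ n in atTop, ∀ p, Quad.SameTriple p ((Quad.step B)^[n] q) → mk p ∈ O := by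
  induction hO with
  | basic O hO =>
    obtain ⟨α, m, β, U, -, -, hU, -, rfl⟩ := hO
    exact eventually_sameTriple_mk_mem_basicSet hU hq
  | univ => exact .of_forall fun _ _ _ => trivial
  | inter O O' _ _ ih ih' =>
    filter_upwards [ih hq.1, ih' hq.2] with n hn hn' p hp using ⟨hn p hp, hn' p hp⟩
  | sUnion 𝒪 _ ih =>
    obtain ⟨O, hO, hqO⟩ := hq
    filter_upwards [ih O hO hqO] with n hn p hp using ⟨O, hO, hn p hp⟩

theorem exists_agree_mk_mem {O : Set (KEP A B)} (hO : IsOpen O) {q : Quad A} (hq : mk q ∈ O) :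
    ∃ n, ∀ p, Quad.SameTriple p q → InfPath.Agree n p.y q.y → mk p ∈ O := by
  obtain ⟨n, hn⟩ := (eventually_sameTriple_mk_mem hO hq).exists
  refine ⟨n, fun p hp hy => ?_⟩
  rw [← mk_iterate n]
  exact hn _ (hp.iterate_step hy)

theorem continuous_unit : Continuous (unit : InfPath A → KEP A B) := by
  refine ⟨fun O hO => InfPath.isOpen_iff.2 fun x hx => ?_⟩
  obtain ⟨n, hn⟩ := exists_agree_mk_mem hO hx
  refine ⟨n + 1, fun z hz => hn _ ?_ (hz.mono n.le_succ)⟩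
  have hstart : (FinPath.vertex z.start : FinPath A) = FinPath.vertex x.start :=
    congrArg (fun e : Edge A => FinPath.vertex e.src) (hz 0 n.succ_pos)
  exact ⟨hstart, rfl, hstart⟩

end KEP

end Quadruples

section InfPathFrom

/-- The infinite paths with source `v`. -/
abbrev InfPathFrom (A : Matrix (Fin N) (Fin N) ℤ) (v : Fin N) : Type :=
  {y : InfPath A // v = y.start}

theorem isCompact_setOf_eq_start (v : Fin N) : IsCompact {y : InfPath A | v = y.start} := by
  have hcyl : {y : InfPath A | v = y.start} = (FinPath.vertex v : FinPath A).cylinder := by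
    ext y
    constructor
    · exact fun h => ⟨y, h, rfl⟩
    · rintro ⟨z, h, rfl⟩
      exact h
  exact hcyl ▸ (FinPath.isClosed_cylinder _).isCompact

instance (v : Fin N) : CompactSpace (InfPathFrom A v) :=
  isCompact_iff_compactSpace.1 (isCompact_setOf_eq_start v)

theorem infPath_act_act_neg (m : ℤ) (y : InfPath A) : (y.act B (-m)).act B m = y := by
  rw [← InfPath.act_add, add_neg_cancel, InfPath.act_zero]

theorem infPath_act_injective (m : ℤ) :
    Function.Injective (InfPath.act B m : InfPath A → InfPath A) := by
  refine Function.LeftInverse.injective (g := InfPath.act B (-m)) fun y => ?_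
  rw [← InfPath.act_add, neg_add_cancel, InfPath.act_zero]

end InfPathFrom

section Cells

/-- An infinite path as a unit of the groupoid. -/
def unitPt (x : InfPath A) : UnitSpace (KEP A B) := ⟨KEP.unit x, rfl⟩

variable {S : Set (UnitSpace (KEP A B))}

/-- `Z(α) ⊆ S` for a finite path `α`. -/
def InSet (S : Set (UnitSpace (KEP A B))) (α : FinPath A) : Prop :=
  ∀ x ∈ α.cylinder, unitPt x ∈ S

/-- The finite paths `α` with `Z(α) ⊆ S`. -/
abbrev PathIn (S : Set (UnitSpace (KEP A B))) : Type := {α : FinPath A // InSet S α}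

/-- The path `α e`. -/
def PathIn.snoc (α : PathIn S) (e : OutEdge A α.1.tgt) : PathIn S :=
  ⟨α.1.snoc e.1 e.2, fun x hx => α.2 x (α.1.cylinder_snoc_subset e.1 e.2 hx)⟩

theorem exists_forall_length_inSet (hS : IsOpen S) {x : InfPath A} (hx : unitPt x ∈ S) :
    ∃ n, ∀ α : FinPath A, n ≤ α.edges.length → x ∈ α.cylinder → InSet S α := by
  have hopen : IsOpen (unitPt ⁻¹' S : Set (InfPath A)) :=
    hS.preimage (KEP.continuous_unit.subtype_mk _)
  obtain ⟨n, hn⟩ := InfPath.isOpen_iff.1 hopen x hx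
  exact ⟨n, fun α hα hxα z hz => hn z ((FinPath.agree_of_mem_cylinder hz hxα).mono hα)⟩

theorem eventually_inSet_iterate_step (hS : IsOpen S) {q : Quad A} (hs : unitPt q.pt ∈ S)
    (hr : unitPt (q.im B) ∈ S) :
    ∀ᶠ k in atTop, InSet S ((Quad.step B)^[k] q).α ∧ InSet S ((Quad.step B)^[k] q).β := by
  obtain ⟨n, hn⟩ := exists_forall_length_inSet hS hr
  obtain ⟨n', hn'⟩ := exists_forall_length_inSet hS hs
  filter_upwards [eventually_ge_atTop n, eventually_ge_atTop n'] with k hk hk'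
  obtain ⟨hlα, hlβ⟩ := KEP.length_iterate (B := B) k q
  refine ⟨hn _ (by omega) ?_, hn' _ (by omega) ?_⟩
  · exact Quad.im_iterate_step k q ▸ Quad.im_mem_cylinder _
  · exact Quad.pt_iterate_step (B := B) k q ▸ Quad.pt_mem_cylinder _

/-- The triples `(α, m, β)` with `r(α) = r(β)` and `Z(α), Z(β) ⊆ S`. They index the
basic compact open bisections `Z(α, m, β)` of the restriction of the groupoid to `S`. -/
@[ext]
structure Cell (S : Set (UnitSpace (KEP A B))) where
  α : PathIn S
  m : ℤ
  β : PathIn S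
  tgt_eq : α.1.tgt = β.1.tgt

namespace Cell

/-- The edge `κ_m(e)`, which continues `α` when `e` continues `β`. -/
def actEdge (t : Cell S) (e : OutEdge A t.β.1.tgt) : OutEdge A t.α.1.tgt :=
  ⟨act B t.m e.1, t.tgt_eq.trans e.2⟩

/-- The triple `(α κ_m(e), φ(m, e), β e)`. -/
def child (t : Cell S) (e : OutEdge A t.β.1.tgt) : Cell S where
  α := t.α.snoc (t.actEdge e)
  m := coc B t.m e.1
  β := t.β.snoc e
  tgt_eq := rfl

theorem child_injective (t : Cell S) : Function.Injective t.child := fun e e' h =>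
  Subtype.ext (FinPath.snoc_inj (hα := e.2) (hβ := e'.2)
    (congrArg (fun c : Cell S => c.β.1) h)).2

/-- The quadruple `(α, m, β; β y)`. -/
def quad (t : Cell S) (y : InfPathFrom A t.β.1.tgt) : Quad A :=
  ⟨t.α.1, t.m, t.β.1, y.1, t.tgt_eq.trans y.2, y.2⟩

/-- The arrow `[α, m, β; β y]`. -/
def arrow (t : Cell S) (y : InfPathFrom A t.β.1.tgt) : Restriction S :=
  ⟨KEP.mk (t.quad y), t.β.2 _ (t.quad y).pt_mem_cylinder, t.α.2 _ (t.quad y).im_mem_cylinder⟩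

/-- The set `Z(α, m, β)` of all arrows `[α, m, β; x]`. -/
def arrows (t : Cell S) : Set (Restriction S) := Set.range t.arrow

theorem mem_arrows_of_sameTriple {t : Cell S} {g : Restriction S} {q : Quad A}
    (hg : g.1 = KEP.mk q) (hα : q.α = t.α.1) (hm : q.m = t.m) (hβ : q.β = t.β.1) :
    g ∈ t.arrows :=
  ⟨⟨q.y, hβ ▸ q.hβ⟩, Subtype.ext
    (hg.trans (congrArg KEP.mk (Quad.ext_of (q := t.quad _) hα hm hβ rfl))).symm⟩

theorem iUnion_arrows_child (t : Cell S) : ⋃ e, (t.child e).arrows = t.arrows := by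
  refine Set.Subset.antisymm (Set.iUnion_subset fun e => ?_) ?_
  · rintro _ ⟨y, rfl⟩
    exact ⟨⟨y.1.cons e.1 y.2, e.2⟩, Subtype.ext (KEP.mk_step (t.quad ⟨y.1.cons e.1 y.2, e.2⟩)).symm⟩
  · rintro _ ⟨y, rfl⟩
    exact Set.mem_iUnion.2 ⟨⟨y.1.1 0, y.2⟩, ⟨y.1.shift, (InfPath.start_shift y.1).symm⟩,
      Subtype.ext (KEP.mk_step (t.quad y))⟩

theorem arrows_child_subset (t : Cell S) (e : OutEdge A t.β.1.tgt) :
    (t.child e).arrows ⊆ t.arrows :=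
  t.iUnion_arrows_child ▸ Set.subset_iUnion (fun e => (t.child e).arrows) e

theorem eq_of_mem_arrows (hpf : PseudoFree A B) {t t' : Cell S}
    (hl : t.β.1.edges.length = t'.β.1.edges.length) {g : Restriction S} (h : g ∈ t.arrows)
    (h' : g ∈ t'.arrows) : t = t' := by
  obtain ⟨y, rfl⟩ := h
  obtain ⟨y', hyy'⟩ := h'
  have hquad : t.quad y = t'.quad y' :=
    KEP.eq_of_mk_eq_mk hpf hl (congrArg Subtype.val hyy'.symm)
  exact Cell.ext (Subtype.ext (congrArg Quad.α hquad)) (congrArg Quad.m hquad)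
    (Subtype.ext (congrArg Quad.β hquad))

variable (S) in
/-- The tree of the basic bisections `Z(α, m, β)`, the level being the length of `β`. -/
noncomputable def tree (hA : NoSinks A) (hpf : PseudoFree A B) :
    SetTree (Restriction S) (Cell S) where
  cell := arrows
  level t := t.β.1.edges.length
  children t := Finset.univ.map ⟨t.child, t.child_injective⟩
  cell_nonempty t :=
    let ⟨y, hy⟩ := hA.exists_infPath t.β.1.tgt
    ⟨_, ⟨y, hy⟩, rfl⟩
  iUnion_cell_children t := by
    simp only [Finset.mem_map, Finset.mem_univ, true_and, Function.Embedding.coeFn_mk,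
      Set.iUnion_exists, Set.iUnion_iUnion_eq', iUnion_arrows_child]
  level_child t c hc := by
    obtain ⟨e, -, rfl⟩ := Finset.mem_map.1 hc
    simp [child, PathIn.snoc, FinPath.snoc]
  disjoint_cell t t' hl hne :=
    Set.disjoint_left.2 fun _ h h' => hne (eq_of_mem_arrows hpf hl h h')

theorem isOpen_arrows (t : Cell S) : IsOpen t.arrows := by
  have hbasic : IsOpen (KEP.basicSet t.α.1 t.m t.β.1 t.β.1.cylinder : Set (KEP A B)) :=
    TopologicalSpace.isOpen_generateFrom_of_mem ⟨_, _, _, _, t.tgt_eq,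
      t.β.1.isClosed_cylinder.isCompact, t.β.1.isOpen_cylinder, subset_rfl, rfl⟩
  have hpre : t.arrows = Subtype.val ⁻¹' (KEP.basicSet t.α.1 t.m t.β.1 t.β.1.cylinder) := by
    ext g
    constructor
    · rintro ⟨y, rfl⟩
      exact ⟨t.quad y, rfl, rfl, rfl, (t.quad y).pt_mem_cylinder, rfl⟩
    · rintro ⟨q, hα, hm, hβ, -, hg⟩
      exact mem_arrows_of_sameTriple hg hα hm hβ
  exact hpre ▸ hbasic.preimage continuous_subtype_val

theorem continuous_arrow (t : Cell S) : Continuous t.arrow := by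
  refine Continuous.subtype_mk ⟨fun O hO => isOpen_iff_forall_mem_open.2 fun y hy => ?_⟩ _
  obtain ⟨n, hn⟩ := KEP.exists_agree_mk_mem hO hy
  refine ⟨Subtype.val ⁻¹' {z | InfPath.Agree n z y.1},
    fun z hz => hn (t.quad z) ⟨rfl, rfl, rfl⟩ hz, ?_, fun i _ => rfl⟩
  exact (InfPath.isOpen_iff.2 fun x hx => ⟨n, fun z hz => hz.trans hx⟩).preimage
    continuous_subtype_val

theorem isCompact_arrows (t : Cell S) : IsCompact t.arrows := isCompact_range t.continuous_arrow

/-- The triple `(β, m, β)`. For `m = 0` it indexes the units in `Z(β)`. -/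
def loop (β : PathIn S) (m : ℤ) : Cell S := ⟨β, m, β, rfl⟩

theorem src_arrow (t : Cell S) (y : InfPathFrom A t.β.1.tgt) :
    src (t.arrow y) = (loop t.β 0).arrow y :=
  Subtype.ext (KEP.mk_eq_unit t.β.1 y.1 y.2).symm

theorem rng_arrow (t : Cell S) (y : InfPathFrom A t.β.1.tgt) :
    rng (t.arrow y) = (loop t.α 0).arrow ⟨y.1.act B t.m, t.tgt_eq.trans y.2⟩ :=
  Subtype.ext (KEP.mk_eq_unit t.α.1 (y.1.act B t.m) (t.tgt_eq.trans y.2)).symm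

theorem src_comp_arrow_injective (t : Cell S) : Function.Injective (src ∘ t.arrow) := by
  intro y y' h
  have hpt : (t.quad y).pt = (t.quad y').pt := KEP.unit_inj (congrArg Subtype.val h)
  exact Subtype.ext (FinPath.append_inj rfl hpt).2

theorem rng_comp_arrow_injective (t : Cell S) : Function.Injective (rng ∘ t.arrow) := by
  intro y y' h
  have him : (t.quad y).im B = (t.quad y').im B := KEP.unit_inj (congrArg Subtype.val h)
  exact Subtype.ext (infPath_act_injective t.m (FinPath.append_inj rfl him).2)

theorem isCompactOpenBisection_arrows (t : Cell S) : IsCompactOpenBisection t.arrows where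
  isCompact := t.isCompact_arrows
  isOpen := t.isOpen_arrows
  injOn_src := by
    rintro _ ⟨y, rfl⟩ _ ⟨y', rfl⟩ h
    rw [t.src_comp_arrow_injective h]
  injOn_rng := by
    rintro _ ⟨y, rfl⟩ _ ⟨y', rfl⟩ h
    rw [t.rng_comp_arrow_injective h]

theorem image_src_arrows (t : Cell S) : src '' t.arrows = (loop t.β 0).arrows := by
  rw [arrows, ← Set.range_comp]
  exact congrArg Set.range (funext t.src_arrow)

theorem image_rng_arrows (t : Cell S) : rng '' t.arrows = (loop t.α 0).arrows := by
  rw [arrows, ← Set.range_comp]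
  refine Set.Subset.antisymm ?_ ?_
  · rintro _ ⟨y, rfl⟩
    exact ⟨_, (t.rng_arrow y).symm⟩
  · rintro _ ⟨y, rfl⟩
    refine ⟨⟨y.1.act B (-t.m), t.tgt_eq.symm.trans y.2⟩, (t.rng_arrow _).trans ?_⟩
    exact congrArg (loop t.α 0).arrow (Subtype.ext (infPath_act_act_neg t.m y.1))

/-- The product `(α, m, β) (β, m', γ) = (α, m + m', γ)`. -/
def comp (t t' : Cell S) (h : t.β = t'.α) : Cell S :=
  ⟨t.α, t.m + t'.m, t'.β, by rw [t.tgt_eq, h, t'.tgt_eq]⟩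

/-- The path `κ_{m'}(y)`, so that `[α, m, β; β κ_{m'}(y)]` and `[β, m', γ; γ y]` are
composable. -/
def actPath {t t' : Cell S} (h : t.β = t'.α) (y : InfPathFrom A t'.β.1.tgt) :
    InfPathFrom A t.β.1.tgt :=
  ⟨y.1.act B t'.m, (congrArg (fun γ : PathIn S => γ.1.tgt) h).trans (t'.tgt_eq.trans y.2)⟩

theorem src_arrow_actPath {t t' : Cell S} (h : t.β = t'.α) (y : InfPathFrom A t'.β.1.tgt) :
    src (t.arrow (actPath h y)) = rng (t'.arrow y) := by
  have hval : t.β.1 = t'.α.1 := congrArg Subtype.val h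
  rw [src_arrow, rng_arrow]
  exact Subtype.ext (congrArg KEP.mk (Quad.ext_of hval rfl hval rfl))

theorem mul_arrow {t t' : Cell S} (h : t.β = t'.α) (y : InfPathFrom A t'.β.1.tgt) :
    mul (t.arrow (actPath h y)) (t'.arrow y) (src_arrow_actPath h y) = (t.comp t' h).arrow y :=
  Subtype.ext (KEP.mul_mk (p := t.quad _) (q := t'.quad y) ⟨congrArg Subtype.val h, rfl⟩)

theorem mulSet_arrows {t t' : Cell S} (h : t.β = t'.α) :
    mulSet t.arrows t'.arrows = (t.comp t' h).arrows := by
  ext g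
  constructor
  · rintro ⟨_, ⟨z, rfl⟩, _, ⟨y, rfl⟩, hzy, rfl⟩
    obtain rfl : z = actPath h y :=
      t.src_comp_arrow_injective (hzy.trans (src_arrow_actPath h y).symm)
    exact ⟨y, (mul_arrow h y).symm⟩
  · rintro ⟨y, rfl⟩
    exact ⟨_, ⟨actPath h y, rfl⟩, _, ⟨y, rfl⟩, src_arrow_actPath h y, (mul_arrow h y).symm⟩

theorem eventually_exists_cell (hS : IsOpen S) {O : Set (Restriction S)} (hO : IsOpen O)
    {g : Restriction S} (hgO : g ∈ O) {q : Quad A} (hg : g.1 = KEP.mk q) :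
    ∀ᶠ k in atTop, ∃ t : Cell S, t.α.1 = ((Quad.step B)^[k] q).α ∧
      t.β.1 = ((Quad.step B)^[k] q).β ∧ g ∈ t.arrows ∧ t.arrows ⊆ O := by
  obtain ⟨O', hO', rfl⟩ := isOpen_induced_iff.1 hO
  have hsrc : unitPt q.pt ∈ S := by
    have h := g.2.1
    rwa [hg] at h
  have hrng : unitPt (q.im B) ∈ S := by
    have h := g.2.2
    rwa [hg] at h
  filter_upwards [KEP.eventually_sameTriple_mk_mem hO' (hg ▸ hgO : KEP.mk q ∈ O'),
    eventually_inSet_iterate_step hS hsrc hrng] with k hkO hkS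
  set p := (Quad.step B)^[k] q with hp
  refine ⟨⟨⟨p.α, hkS.1⟩, p.m, ⟨p.β, hkS.2⟩, p.hα.trans p.hβ.symm⟩, rfl, rfl,
    mem_arrows_of_sameTriple (q := p) ?_ rfl rfl rfl, ?_⟩
  · rw [hg, hp, KEP.mk_iterate]
  · rintro _ ⟨y, rfl⟩
    exact hkO _ ⟨rfl, rfl, rfl⟩

theorem exists_mem_arrows_subset (hS : IsOpen S) {O : Set (Restriction S)} (hO : IsOpen O)
    {g : Restriction S} (hgO : g ∈ O) : ∃ t : Cell S, g ∈ t.arrows ∧ t.arrows ⊆ O := by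
  obtain ⟨q, hq⟩ := Quot.exists_rep g.1
  obtain ⟨-, t, -, -, ht⟩ := (eventually_exists_cell hS hO hgO hq.symm).exists
  exact ⟨t, ht⟩

theorem exists_composable_cells (hS : IsOpen S) {U V : Set (Restriction S)} (hU : IsOpen U)
    (hV : IsOpen V) {g h : Restriction S} (hg : g ∈ U) (hh : h ∈ V) (hgh : src g = rng h) :
    ∃ t t' : Cell S, t.arrows ⊆ U ∧ h ∈ t'.arrows ∧ t'.arrows ⊆ V ∧ t.β = t'.α := by
  obtain ⟨q, hq⟩ := Quot.exists_rep g.1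
  obtain ⟨p, hp⟩ := Quot.exists_rep h.1
  obtain ⟨k, ⟨t, -, htβ, -, htU⟩, t', ht'α, -, hht', ht'V⟩ :=
    (((tendsto_add_atTop_nat p.α.edges.length).eventually
      (eventually_exists_cell hS hU hg hq.symm)).and
    ((tendsto_add_atTop_nat q.β.edges.length).eventually
      (eventually_exists_cell hS hV hh hp.symm))).exists
  have hpt : q.pt = p.im B := by
    have hsr : KEP.s g.1 = KEP.r h.1 := KEP.unit_inj (congrArg Subtype.val hgh)
    rwa [← hq, ← hp] at hsr
  refine ⟨t, t', htU, hht', ht'V, Subtype.ext ?_⟩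
  refine htβ.trans (Eq.trans (KEP.matched_of (B := B) ?_ ?_).1 ht'α.symm)
  · rw [(KEP.length_iterate _ _).1, (KEP.length_iterate _ _).2]
    omega
  · rw [Quad.pt_iterate_step, Quad.im_iterate_step, hpt]

end Cell

end Cells

end Katsura

namespace Katsura

open ArrowGroupoid Matrix

variable {N : ℕ} {A B : Matrix (Fin N) (Fin N) ℤ} {S : Set (UnitSpace (KEP A B))}
  {𝕜 : Type*} [Field 𝕜]

section CellWeights

namespace Cell

/-- The values of functionals on the indicators of the basic bisections `Z(α, m, β)`. -/
noncomputable def weight : ((Restriction S → 𝕜) →ₗ[𝕜] 𝕜) →ₗ[𝕜] Cell S → 𝕜 where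
  toFun l t := l (t.arrows.indicator 1)
  map_add' _ _ := rfl
  map_smul' _ _ := rfl

theorem weight_apply (l : (Restriction S → 𝕜) →ₗ[𝕜] 𝕜) (t : Cell S) :
    weight l t = l (t.arrows.indicator 1) := rfl

/-- Weights which are additive with respect to the product of cells. -/
def IsAdditive (w : Cell S → 𝕜) : Prop :=
  ∀ (t t' : Cell S) (h : t.β = t'.α), w (t.comp t' h) = w t + w t'

theorem isHarmonic_tree_iff (hA : NoSinks A) (hpf : PseudoFree A B) {w : Cell S → 𝕜} :
    (tree S hA hpf).IsHarmonic w ↔ ∀ t, w t = ∑ e, w (t.child e) :=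
  forall_congr' fun t => by simp only [tree, Finset.sum_map, Function.Embedding.coeFn_mk]

theorem weight_eq_sum_child (hA : NoSinks A) (hpf : PseudoFree A B)
    (l : (Restriction S → 𝕜) →ₗ[𝕜] 𝕜) (t : Cell S) :
    weight l t = ∑ e, weight l (t.child e) :=
  (isHarmonic_tree_iff hA hpf).1 ((SetTree.isHarmonic_indicator 1).map l) t

theorem exists_weight_eq (hA : NoSinks A) (hpf : PseudoFree A B) {w : Cell S → 𝕜}
    (hw : ∀ t, w t = ∑ e, w (t.child e)) : ∃ l, weight l = w :=
  ((isHarmonic_tree_iff hA hpf).2 hw).exists_functional.imp fun _ hl => funext hl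

theorem exists_isDecomposition (hA : NoSinks A) (hpf : PseudoFree A B) (hS : IsOpen S)
    {U : Set (Restriction S)} (hU : IsCompactOpenBisection U) :
    ∃ F : Finset (Cell S), IsDecomposition arrows F U := by
  obtain ⟨F, hF, -⟩ := SetTree.IsHereditary.exists_isDecomposition (𝒯 := tree S hA hpf)
    (P := fun _ => True) (fun _ _ _ _ => trivial) isOpen_arrows hU.isCompact
    fun g hg => (exists_mem_arrows_subset hS hU.isOpen hg).imp fun _ ht => ⟨trivial, ht⟩
  exact ⟨F, hF⟩

variable {l : (Restriction S → 𝕜) →ₗ[𝕜] 𝕜}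

theorem map_indicator_image_src {U : Set (Restriction S)} (hU : IsCompactOpenBisection U)
    {F : Finset (Cell S)} (hF : IsDecomposition arrows F U) :
    l ((src '' U).indicator 1) = ∑ t ∈ F, weight l (loop t.β 0) := by
  simp only [(hF.image hU.injOn_src).map_indicator, image_src_arrows, weight_apply]

theorem map_indicator_image_rng {U : Set (Restriction S)} (hU : IsCompactOpenBisection U)
    {F : Finset (Cell S)} (hF : IsDecomposition arrows F U) :
    l ((rng '' U).indicator 1) = ∑ t ∈ F, weight l (loop t.α 0) := by
  simp only [(hF.image hU.injOn_rng).map_indicator, image_rng_arrows, weight_apply]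

theorem mem_invariants_iff (hA : NoSinks A) (hpf : PseudoFree A B) (hS : IsOpen S) :
    l ∈ invariants 𝕜 (Restriction S) ↔
      ∀ t : Cell S, weight l (loop t.β 0) = weight l (loop t.α 0) := by
  refine ⟨fun hl t => ?_, fun hl U hU => ?_⟩
  · simpa only [weight_apply, image_src_arrows, image_rng_arrows] using
      hl t.arrows t.isCompactOpenBisection_arrows
  · obtain ⟨F, hF⟩ := exists_isDecomposition hA hpf hS hU
    rw [map_indicator_image_src hU hF, map_indicator_image_rng hU hF]
    exact Finset.sum_congr rfl fun t _ => hl t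

theorem mem_nullFunctionals_iff (hA : NoSinks A) (hpf : PseudoFree A B) (hS : IsOpen S) :
    l ∈ nullFunctionals 𝕜 (Restriction S) ↔ ∀ β : PathIn S, weight l (loop β 0) = 0 := by
  refine ⟨fun hl β => ?_, fun hl U hU => ?_⟩
  · simpa only [weight_apply, image_src_arrows] using! hl _ (loop β 0).isCompactOpenBisection_arrows
  · obtain ⟨F, hF⟩ := exists_isDecomposition hA hpf hS hU
    rw [map_indicator_image_src hU hF]
    exact Finset.sum_eq_zero fun t _ => hl t.β

theorem mem_coboundaries_iff (hA : NoSinks A) (hpf : PseudoFree A B) (hS : IsOpen S) :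
    l ∈ coboundaries 𝕜 (Restriction S) ↔ ∃ k : (Restriction S → 𝕜) →ₗ[𝕜] 𝕜, ∀ t : Cell S,
      weight l t = weight k (loop t.β 0) - weight k (loop t.α 0) := by
  refine exists_congr fun k => ⟨fun hk t => ?_, fun hk U hU => ?_⟩
  · simpa only [weight_apply, image_src_arrows, image_rng_arrows] using
      hk t.arrows t.isCompactOpenBisection_arrows
  · obtain ⟨F, hF⟩ := exists_isDecomposition hA hpf hS hU
    rw [map_indicator_image_src hU hF, map_indicator_image_rng hU hF, hF.map_indicator,
      ← Finset.sum_sub_distrib]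
    exact Finset.sum_congr rfl fun t _ => hk t

theorem isHereditary_exists_composable (hA : NoSinks A) (hpf : PseudoFree A B)
    (U : Set (Restriction S)) :
    (tree S hA hpf).IsHereditary fun t' => ∃ t : Cell S, t.arrows ⊆ U ∧ t.β = t'.α := by
  rintro t' ⟨t, htU, h⟩ _ hc
  obtain ⟨e, -, rfl⟩ := Finset.mem_map.1 hc
  obtain ⟨α, m, β, hαβ⟩ := t
  obtain rfl : β = t'.α := h
  set t : Cell S := ⟨α, m, t'.α, hαβ⟩
  exact ⟨t.child (t'.actEdge e), (t.arrows_child_subset _).trans htU, rfl⟩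

theorem exists_composable_decompositions (hA : NoSinks A) (hpf : PseudoFree A B) (hS : IsOpen S)
    {U V : Set (Restriction S)} (hU : IsCompactOpenBisection U) (hV : IsCompactOpenBisection V)
    (hUV : src '' U = rng '' V) :
    ∃ (F : Finset (Cell S)) (τ : Cell S → Cell S), IsDecomposition arrows F V ∧
      ∀ t' ∈ F, (τ t').arrows ⊆ U ∧ (τ t').β = t'.α := by
  have hcover : ∀ h ∈ V, ∃ t' : Cell S, (∃ t : Cell S, t.arrows ⊆ U ∧ t.β = t'.α) ∧
      h ∈ t'.arrows ∧ t'.arrows ⊆ V := fun h hh => by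
    obtain ⟨g, hg, hgh⟩ := hUV.ge ⟨h, hh, rfl⟩
    obtain ⟨t, t', htU, hht', ht'V, hβα⟩ :=
      exists_composable_cells hS hU.isOpen hV.isOpen hg hh hgh
    exact ⟨t', ⟨t, htU, hβα⟩, hht', ht'V⟩
  obtain ⟨F, hF, hτ⟩ := (isHereditary_exists_composable hA hpf U).exists_isDecomposition
    isOpen_arrows hV.isCompact hcover
  choose! τ hτ using hτ
  exact ⟨F, τ, hF, hτ⟩

theorem mem_cocycles_iff (hA : NoSinks A) (hpf : PseudoFree A B) (hS : IsOpen S) :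
    l ∈ cocycles 𝕜 (Restriction S) ↔ IsAdditive (weight l) := by
  refine ⟨fun hl t t' h => ?_, fun hl U hU V hV hUV => ?_⟩
  · simpa only [weight_apply, mulSet_arrows h] using hl _ t.isCompactOpenBisection_arrows
      _ t'.isCompactOpenBisection_arrows (by rw [image_src_arrows, image_rng_arrows, h])
  · obtain ⟨F, τ, hF, hτ⟩ := exists_composable_decompositions hA hpf hS hU hV hUV
    have hτU : ∀ t' ∈ F, (τ t').arrows ⊆ U := fun t' ht' => (hτ t' ht').1
    have hτF : ∀ t' ∈ F, src '' (τ t').arrows = rng '' t'.arrows := fun t' ht' => by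
      rw [image_src_arrows, image_rng_arrows, (hτ t' ht').2]
    rw [(isDecomposition_left_of_image_eq hU.injOn_src hV.injOn_rng hUV hF hτU hτF).map_indicator,
      (isDecomposition_mulSet hU.injOn_src hV.injOn_src hUV hF hτU hτF).map_indicator,
      hF.map_indicator, ← Finset.sum_add_distrib]
    refine Finset.sum_congr rfl fun t' ht' => ?_
    rw [mulSet_arrows (hτ t' ht').2]
    exact hl _ _ _

end Cell

end CellWeights

section Vertices

/-- The ranges of the finite paths `α` with `Z(α) ⊆ S`. -/
def vertices (S : Set (UnitSpace (KEP A B))) : Set (Fin N) :=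
  Set.range fun α : PathIn S => α.1.tgt

noncomputable instance (S : Set (UnitSpace (KEP A B))) : DecidablePred (· ∈ vertices S) :=
  Classical.decPred _

theorem tgt_mem_vertices {e : Edge A} (he : e.src ∈ vertices S) : e.tgt ∈ vertices S := by
  obtain ⟨α, hα⟩ := he
  exact ⟨α.snoc ⟨e, hα⟩, rfl⟩

theorem mem_vertices_of_ne_zero (hA : ∀ i j, 0 ≤ A i j) {v w : Fin N} (hv : v ∈ vertices S)
    (hvw : A v w ≠ 0) : w ∈ vertices S :=
  tgt_mem_vertices (e := ⟨v, w, 0, le_rfl, (hA v w).lt_of_ne hvw.symm⟩) hv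

/-- The block `M_S` of the matrix `M` on the vertices in `vertices S`, with entries in `𝕜`. -/
def verticesBlock (𝕜 : Type*) [Field 𝕜] (S : Set (UnitSpace (KEP A B)))
    (M : Matrix (Fin N) (Fin N) ℤ) : Matrix (vertices S) (vertices S) 𝕜 :=
  (M.map (Int.cast : ℤ → 𝕜)).toSquareBlockProp (· ∈ vertices S)

theorem mem_vertices_of_map_ne_zero (hA : ∀ i j, 0 ≤ A i j) {M : Matrix (Fin N) (Fin N) ℤ}
    (hM : ∀ i j, A i j = 0 → M i j = 0) (v w : Fin N) (hv : v ∈ vertices S)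
    (hvw : M.map (Int.cast : ℤ → 𝕜) v w ≠ 0) : w ∈ vertices S :=
  mem_vertices_of_ne_zero hA hv fun h => hvw (by rw [map_apply, hM v w h, Int.cast_zero])

theorem verticesBlock_mulVec (hA : ∀ i j, 0 ≤ A i j) {M : Matrix (Fin N) (Fin N) ℤ}
    (hM : ∀ i j, A i j = 0 → M i j = 0) (z : Fin N → 𝕜) (v : vertices S) :
    (verticesBlock 𝕜 S M *ᵥ (z ∘ Subtype.val)) v = ∑ w, M v w • z w := by
  simp only [zsmul_eq_mul]
  exact congrFun (toSquareBlockProp_mulVec _ (mem_vertices_of_map_ne_zero hA hM) z) v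

namespace PathIn

/-- The range of the path `β`, as an element of `vertices S`. -/
def vertex (β : PathIn S) : vertices S := ⟨β.1.tgt, β, rfl⟩

/-- A chosen path with range `v`. -/
noncomputable def base (v : vertices S) : PathIn S := v.2.choose

theorem vertex_base (v : vertices S) : (base v).vertex = v := Subtype.ext v.2.choose_spec

theorem sum_vertex_snoc (hA : ∀ i j, 0 ≤ A i j) (x : vertices S → 𝕜) (β : PathIn S) :
    ∑ e, x (β.snoc e).vertex = (verticesBlock 𝕜 S A *ᵥ x) β.vertex := by
  obtain ⟨z, rfl⟩ := Subtype.val_injective.surjective_comp_right x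
  rw [verticesBlock_mulVec hA fun _ _ h => h]
  exact sum_outEdge_tgt hA _ z

theorem sum_coc_mul_vertex_snoc (hA : ∀ i j, 0 ≤ A i j) (hsupp : ∀ i j, A i j = 0 → B i j = 0)
    (x : vertices S → 𝕜) (β : PathIn S) (m : ℤ) :
    ∑ e : OutEdge A β.1.tgt, coc B m e.1 * x (β.snoc e).vertex =
      m * (verticesBlock 𝕜 S B *ᵥ x) β.vertex := by
  obtain ⟨z, rfl⟩ := Subtype.val_injective.surjective_comp_right x
  rw [verticesBlock_mulVec hA hsupp]
  simp only [← zsmul_eq_mul]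
  exact sum_coc_smul_tgt hA hsupp _ m z

/-- The operator `(Δ a)(β) = ∑ₑ a(β e) - a(β)`. Its kernel consists of the finitely additive
measures `Z(β) ↦ a(β)`. -/
noncomputable def laplacian : (PathIn S → 𝕜) →ₗ[𝕜] PathIn S → 𝕜 where
  toFun a β := ∑ e, a (β.snoc e) - a β
  map_add' a a' := funext fun β => by
    simp only [Pi.add_apply, Finset.sum_add_distrib, add_sub_add_comm]
  map_smul' c a := funext fun β => by
    simp only [Pi.smul_apply, ← Finset.smul_sum, ← smul_sub, RingHom.id_apply]

theorem laplacian_apply (a : PathIn S → 𝕜) (β : PathIn S) :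
    laplacian a β = ∑ e, a (β.snoc e) - a β := rfl

theorem laplacian_comp_vertex (hA : ∀ i j, 0 ≤ A i j) (x : vertices S → 𝕜) :
    laplacian (x ∘ vertex) = (-(1 - verticesBlock 𝕜 S A).mulVecLin x) ∘ vertex := by
  funext β
  rw [laplacian_apply, Function.comp_apply, Function.comp_apply, Pi.neg_apply, mulVecLin_apply,
    sub_mulVec, one_mulVec, Pi.sub_apply, neg_sub, ← sum_vertex_snoc hA]
  rfl

end PathIn

theorem exists_path_potential {M : Type*} [AddCommMonoid M] (hA : NoSinks A) (f : Fin N → M) :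
    ∃ a : FinPath A → M, ∀ β : FinPath A,
      ∑ e : OutEdge A β.tgt, a (β.snoc e.1 e.2) = a β + f β.tgt := by
  classical
  choose γ hγ using hA
  refine ⟨fun β => β.edges.foldl (fun x e => if e = γ e.src then x + f e.src else 0) 0,
    fun β => ?_⟩
  rw [Finset.sum_eq_single ⟨γ β.tgt, (hγ _).symm⟩]
  · simp [FinPath.snoc, hγ]
  · rintro ⟨e, he⟩ - hne
    have hne' : e ≠ γ e.src := fun h => hne (Subtype.ext (h.trans (congrArg γ he.symm)))
    simp [FinPath.snoc, hne']
  · simp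

theorem PathIn.exists_laplacian_eq (hA : NoSinks A) (d : vertices S → 𝕜) :
    ∃ a : PathIn S → 𝕜, laplacian a = d ∘ vertex := by
  obtain ⟨f, rfl⟩ := Subtype.val_injective.surjective_comp_right d
  obtain ⟨a, ha⟩ := exists_path_potential hA f
  refine ⟨a ∘ Subtype.val, funext fun β => ?_⟩
  rw [laplacian_apply, sub_eq_iff_eq_add']
  exact ha β.1

end Vertices

section InvariantDim

namespace Cell

open PathIn

theorem child_loop_zero (β : PathIn S) (e : OutEdge A β.1.tgt) :
    (loop β 0).child e = loop (β.snoc e) 0 := by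
  have hact : (loop β 0).actEdge e = e := Subtype.ext (act_coc_zero B e.1).1
  exact Cell.ext (congrArg β.snoc hact) (act_coc_zero B e.1).2 rfl

theorem vertex_eq (t : Cell S) : t.α.vertex = t.β.vertex := Subtype.ext t.tgt_eq

/-- The triple `(β, 0, β')` where `β'` is the chosen path with the range of `β`. -/
noncomputable def toBase (β : PathIn S) : Cell S :=
  ⟨β, 0, base β.vertex, congrArg Subtype.val (vertex_base β.vertex).symm⟩

/-- The measures of the sets `Z(β)`, as functions of `β`. -/
noncomputable def unitWeight : ((Restriction S → 𝕜) →ₗ[𝕜] 𝕜) →ₗ[𝕜] PathIn S → 𝕜 :=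
  LinearMap.funLeft 𝕜 𝕜 (fun β => loop β 0) ∘ₗ weight

theorem unitWeight_apply (l : (Restriction S → 𝕜) →ₗ[𝕜] 𝕜) (β : PathIn S) :
    unitWeight l β = weight l (loop β 0) := rfl

theorem laplacian_unitWeight (hA : NoSinks A) (hpf : PseudoFree A B)
    (l : (Restriction S → 𝕜) →ₗ[𝕜] 𝕜) : laplacian (unitWeight l) = 0 := by
  funext β
  rw [laplacian_apply, unitWeight_apply, weight_eq_sum_child hA hpf, Pi.zero_apply, sub_eq_zero]
  exact Finset.sum_congr rfl fun e _ => congrArg (weight l) (child_loop_zero β e).symm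

theorem exists_unitWeight_eq (hA : NoSinks A) (hpf : PseudoFree A B) {u : PathIn S → 𝕜}
    (hu : laplacian u = 0) : ∃ l, unitWeight l = u := by
  obtain ⟨l, hl⟩ := exists_weight_eq hA hpf (w := fun t => u t.β) fun t =>
    (sub_eq_zero.1 (congrFun hu t.β)).symm
  exact ⟨l, funext fun β => congrFun hl (loop β 0)⟩

theorem unitWeight_eq_of_mem_invariants (hA : NoSinks A) (hpf : PseudoFree A B) (hS : IsOpen S)
    {l : (Restriction S → 𝕜) →ₗ[𝕜] 𝕜} (hl : l ∈ invariants 𝕜 (Restriction S)) :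
    unitWeight l = (unitWeight l ∘ base) ∘ vertex :=
  funext fun β => ((mem_invariants_iff hA hpf hS).1 hl (toBase β)).symm

theorem laplacian_comp_vertex_eq_zero_iff (hA : ∀ i j, 0 ≤ A i j) {x : vertices S → 𝕜} :
    laplacian (x ∘ vertex) = 0 ↔ x ∈ LinearMap.ker (1 - verticesBlock 𝕜 S A).mulVecLin := by
  have hsurj : Function.Surjective (vertex : PathIn S → vertices S) := fun v => ⟨_, vertex_base v⟩
  rw [laplacian_comp_vertex hA, ← Pi.zero_comp vertex, hsurj.injective_comp_right.eq_iff,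
    neg_eq_zero, LinearMap.mem_ker]

/-- The values of an invariant functional on the sets `Z(β)`, which depend only on the range of
`β`. -/
noncomputable def invariantVector (hA : ∀ i j, 0 ≤ A i j) (hns : NoSinks A)
    (hpf : PseudoFree A B) (hS : IsOpen S) : invariants 𝕜 (Restriction S) →ₗ[𝕜]
      LinearMap.ker (1 - verticesBlock 𝕜 S A).mulVecLin :=
  ((LinearMap.funLeft 𝕜 𝕜 base ∘ₗ unitWeight).domRestrict _).codRestrict _ fun l =>
    (laplacian_comp_vertex_eq_zero_iff hA).1 <|
      (congrArg laplacian (unitWeight_eq_of_mem_invariants hns hpf hS l.2)).symm.trans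
        (laplacian_unitWeight hns hpf l.1)

theorem invariantVector_surjective (hA : ∀ i j, 0 ≤ A i j) (hns : NoSinks A)
    (hpf : PseudoFree A B) (hS : IsOpen S) :
    Function.Surjective (invariantVector (𝕜 := 𝕜) hA hns hpf hS) := by
  rintro ⟨x, hx⟩
  obtain ⟨l, hl⟩ := exists_unitWeight_eq hns hpf ((laplacian_comp_vertex_eq_zero_iff hA).2 hx)
  have hweight (β : PathIn S) : weight l (loop β 0) = x β.vertex := congrFun hl β
  refine ⟨⟨l, (mem_invariants_iff hns hpf hS).2 fun t => ?_⟩, Subtype.ext (funext fun v => ?_)⟩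
  · rw [hweight, hweight, t.vertex_eq]
  · exact (hweight (base v)).trans (congrArg x (vertex_base v))

theorem invariantVector_eq_zero_iff (hA : ∀ i j, 0 ≤ A i j) (hns : NoSinks A)
    (hpf : PseudoFree A B) (hS : IsOpen S) (l : invariants 𝕜 (Restriction S)) :
    invariantVector hA hns hpf hS l = 0 ↔ l.1 ∈ nullFunctionals 𝕜 (Restriction S) := by
  rw [mem_nullFunctionals_iff hns hpf hS]
  refine ⟨fun h β => ?_, fun h => Subtype.ext (funext fun v => h (base v))⟩
  have hunit := congrFun (unitWeight_eq_of_mem_invariants hns hpf hS l.2) β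
  exact hunit.trans (congrFun (congrArg Subtype.val h) β.vertex)

theorem invariantDim_restriction (hA : ∀ i j, 0 ≤ A i j) (hns : NoSinks A)
    (hpf : PseudoFree A B) (hS : IsOpen S) : invariantDim 𝕜 (Restriction S) =
      Module.finrank 𝕜 (LinearMap.ker (1 - verticesBlock 𝕜 S A).mulVecLin) :=
  finrank_map_mkQ_of_surjective (invariantVector hA hns hpf hS)
    (invariantVector_surjective hA hns hpf hS) (invariantVector_eq_zero_iff hA hns hpf hS)

end Cell

end InvariantDim

section CocycleDim

namespace Cell

open PathIn

theorem actEdge_bijective (t : Cell S) : Function.Bijective t.actEdge := by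
  refine ⟨fun e e' h => ?_, fun e => ?_⟩
  · have hact : act B t.m e.1 = act B t.m e'.1 := congrArg Subtype.val h
    exact Subtype.ext (by rw [← act_neg_act (B := B) t.m e.1, hact, act_neg_act])
  · exact ⟨⟨act B (-t.m) e.1, t.tgt_eq.symm.trans e.2⟩, Subtype.ext (act_act_neg t.m e.1)⟩

/-- The additive weight with potential `a` on paths and value `m b(v)` on the isotropy triples
`(β, m, β)` with `r(β) = v`. -/
def potentialWeight (a : PathIn S → 𝕜) (b : vertices S → 𝕜) (t : Cell S) : 𝕜 :=
  a t.α + t.m * b t.β.vertex - a t.β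

theorem isAdditive_potentialWeight (a : PathIn S → 𝕜) (b : vertices S → 𝕜) :
    IsAdditive (potentialWeight a b) := by
  intro t t' h
  simp only [potentialWeight, comp, h, ← t'.vertex_eq]
  push_cast
  ring

theorem sum_potentialWeight_child (hA : ∀ i j, 0 ≤ A i j)
    (hsupp : ∀ i j, A i j = 0 → B i j = 0) (a : PathIn S → 𝕜) (b : vertices S → 𝕜)
    (t : Cell S) :
    ∑ e, potentialWeight a b (t.child e) = potentialWeight a b t + laplacian a t.α -
      laplacian a t.β - t.m * (1 - verticesBlock 𝕜 S B).mulVecLin b t.β.vertex := by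
  have hα : ∑ e, a (t.α.snoc (t.actEdge e)) = ∑ e, a (t.α.snoc e) :=
    t.actEdge_bijective.sum_comp fun e => a (t.α.snoc e)
  have hb := sum_coc_mul_vertex_snoc hA hsupp b t.β t.m
  simp only [potentialWeight, child, Finset.sum_sub_distrib, Finset.sum_add_distrib, hα, hb,
    laplacian_apply, mulVecLin_apply, sub_mulVec, one_mulVec, Pi.sub_apply]
  ring

variable {w : Cell S → 𝕜}

theorem IsAdditive.loop_eq_mul (hw : IsAdditive w) (β : PathIn S) (m : ℤ) :
    w (loop β m) = m * w (loop β 1) := by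
  let loopHom : ℤ →+ 𝕜 :=
    AddMonoidHom.mk' (fun m => w (loop β m)) fun m m' => hw (loop β m) (loop β m') rfl
  calc w (loop β m) = loopHom (m • 1) := by rw [smul_eq_mul, mul_one]; rfl
    _ = m * w (loop β 1) := by rw [map_zsmul, zsmul_eq_mul]; rfl

theorem IsAdditive.eq_potentialWeight (hw : IsAdditive w) :
    w = potentialWeight (fun β => w (toBase β)) fun v => w (loop (base v) 1) := by
  funext t
  have hright := hw t (toBase t.β) rfl
  have hleft := hw (toBase t.α) (loop (base t.β.vertex) t.m) (congrArg base t.vertex_eq)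
  have hcomp : t.comp (toBase t.β) rfl =
      (toBase t.α).comp (loop (base t.β.vertex) t.m) (congrArg base t.vertex_eq) :=
    Cell.ext rfl (add_comm t.m 0) rfl
  rw [← hcomp, hright, hw.loop_eq_mul] at hleft
  exact eq_sub_of_add_eq hleft

/-- The values `b(v)` of a functional on chosen bisections `Z(β, 1, β)` with `r(β) = v`. -/
noncomputable def loopVector : ((Restriction S → 𝕜) →ₗ[𝕜] 𝕜) →ₗ[𝕜] vertices S → 𝕜 :=
  LinearMap.funLeft 𝕜 𝕜 (fun v => loop (base v) 1) ∘ₗ weight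

/-- The potential on paths of an additive weight. -/
noncomputable def potential : ((Restriction S → 𝕜) →ₗ[𝕜] 𝕜) →ₗ[𝕜] PathIn S → 𝕜 :=
  LinearMap.funLeft 𝕜 𝕜 toBase ∘ₗ weight

/-- The Laplacian of the potential, which for a cocycle depends only on the range of a path. -/
noncomputable def defectVector : ((Restriction S → 𝕜) →ₗ[𝕜] 𝕜) →ₗ[𝕜] vertices S → 𝕜 :=
  LinearMap.funLeft 𝕜 𝕜 base ∘ₗ laplacian ∘ₗ potential

variable {l : (Restriction S → 𝕜) →ₗ[𝕜] 𝕜}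

theorem weight_eq_potentialWeight (hA : NoSinks A) (hpf : PseudoFree A B) (hS : IsOpen S)
    (hl : l ∈ cocycles 𝕜 (Restriction S)) :
    weight l = potentialWeight (potential l) (loopVector l) :=
  ((mem_cocycles_iff hA hpf hS).1 hl).eq_potentialWeight

theorem laplacian_potential_sub (hA : ∀ i j, 0 ≤ A i j)
    (hsupp : ∀ i j, A i j = 0 → B i j = 0) (hns : NoSinks A) (hpf : PseudoFree A B)
    (hS : IsOpen S) (hl : l ∈ cocycles 𝕜 (Restriction S)) (t : Cell S) :
    laplacian (potential l) t.α - laplacian (potential l) t.β =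
      t.m * (1 - verticesBlock 𝕜 S B).mulVecLin (loopVector l) t.β.vertex := by
  have hharmonic := weight_eq_sum_child hns hpf l t
  rw [weight_eq_potentialWeight hns hpf hS hl, sum_potentialWeight_child hA hsupp] at hharmonic
  linear_combination -hharmonic

theorem loopVector_mem_ker (hA : ∀ i j, 0 ≤ A i j) (hsupp : ∀ i j, A i j = 0 → B i j = 0)
    (hns : NoSinks A) (hpf : PseudoFree A B) (hS : IsOpen S)
    (hl : l ∈ cocycles 𝕜 (Restriction S)) :
    loopVector l ∈ LinearMap.ker (1 - verticesBlock 𝕜 S B).mulVecLin := by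
  refine funext fun v => ?_
  have hloop := laplacian_potential_sub hA hsupp hns hpf hS hl (loop (base v) 1)
  simpa [loop, vertex_base] using hloop.symm

theorem laplacian_potential (hA : ∀ i j, 0 ≤ A i j) (hsupp : ∀ i j, A i j = 0 → B i j = 0)
    (hns : NoSinks A) (hpf : PseudoFree A B) (hS : IsOpen S)
    (hl : l ∈ cocycles 𝕜 (Restriction S)) :
    laplacian (potential l) = defectVector l ∘ vertex := by
  refine funext fun β => sub_eq_zero.1 ?_
  have hbase := laplacian_potential_sub hA hsupp hns hpf hS hl (toBase β)
  rwa [loopVector_mem_ker hA hsupp hns hpf hS hl, Pi.zero_apply, mul_zero] at hbase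

theorem exists_cocycle (hA : ∀ i j, 0 ≤ A i j) (hsupp : ∀ i j, A i j = 0 → B i j = 0)
    (hns : NoSinks A) (hpf : PseudoFree A B) (hS : IsOpen S) {b : vertices S → 𝕜}
    (hb : b ∈ LinearMap.ker (1 - verticesBlock 𝕜 S B).mulVecLin) {a : PathIn S → 𝕜}
    {d : vertices S → 𝕜} (ha : laplacian a = d ∘ vertex) :
    ∃ l ∈ cocycles 𝕜 (Restriction S), weight l = potentialWeight a b := by
  obtain ⟨l, hl⟩ := exists_weight_eq hns hpf (w := potentialWeight a b) fun t => by
    rw [sum_potentialWeight_child hA hsupp, ha, LinearMap.mem_ker.1 hb]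
    simp [t.vertex_eq]
  exact ⟨l, (mem_cocycles_iff hns hpf hS).2 (hl ▸ isAdditive_potentialWeight a b), hl⟩

theorem loopVector_of_weight_eq {a : PathIn S → 𝕜} {b : vertices S → 𝕜}
    (hl : weight l = potentialWeight a b) : loopVector l = b := by
  funext v
  refine (congrFun hl (loop (base v) 1)).trans ?_
  simp [potentialWeight, loop, vertex_base]

theorem potential_of_weight_eq {a : PathIn S → 𝕜} {b : vertices S → 𝕜}
    (hl : weight l = potentialWeight a b) : potential l = a - (a ∘ base) ∘ vertex := by
  funext β
  refine (congrFun hl (toBase β)).trans ?_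
  simp [potentialWeight, toBase]

theorem defectVector_of_weight_eq (hA : ∀ i j, 0 ≤ A i j) {a : PathIn S → 𝕜}
    {b d : vertices S → 𝕜} (ha : laplacian a = d ∘ vertex)
    (hl : weight l = potentialWeight a b) :
    defectVector l = d + (1 - verticesBlock 𝕜 S A).mulVecLin (a ∘ base) := by
  funext v
  refine (congrFun (congrArg laplacian (potential_of_weight_eq hl)) (base v)).trans ?_
  rw [map_sub, ha, laplacian_comp_vertex hA]
  simp [vertex_base, sub_eq_add_neg]

theorem mem_coboundaries_iff_exists_unitWeight (hA : NoSinks A) (hpf : PseudoFree A B)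
    (hS : IsOpen S) : l ∈ coboundaries 𝕜 (Restriction S) ↔
      ∃ u : PathIn S → 𝕜, laplacian u = 0 ∧ weight l = potentialWeight (-u) 0 := by
  rw [mem_coboundaries_iff hA hpf hS]
  constructor
  · rintro ⟨k, hk⟩
    refine ⟨unitWeight k, laplacian_unitWeight hA hpf k, funext fun t => (hk t).trans ?_⟩
    simp only [potentialWeight, unitWeight_apply, Pi.neg_apply, Pi.zero_apply]
    ring
  · rintro ⟨u, hu, hl⟩
    obtain ⟨k, rfl⟩ := exists_unitWeight_eq hA hpf hu
    refine ⟨k, fun t => (congrFun hl t).trans ?_⟩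
    simp only [potentialWeight, unitWeight_apply, Pi.neg_apply, Pi.zero_apply]
    ring

theorem mem_coboundaries_iff_loopVector_defectVector (hA : ∀ i j, 0 ≤ A i j)
    (hsupp : ∀ i j, A i j = 0 → B i j = 0) (hns : NoSinks A) (hpf : PseudoFree A B)
    (hS : IsOpen S) (hl : l ∈ cocycles 𝕜 (Restriction S)) :
    l ∈ coboundaries 𝕜 (Restriction S) ↔ loopVector l = 0 ∧
      defectVector l ∈ LinearMap.range (1 - verticesBlock 𝕜 S A).mulVecLin := by
  rw [mem_coboundaries_iff_exists_unitWeight hns hpf hS]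
  constructor
  · rintro ⟨u, hu, hlu⟩
    have hlap : laplacian (-u) = (0 : vertices S → 𝕜) ∘ vertex := by rw [map_neg, hu, neg_zero]; rfl
    refine ⟨loopVector_of_weight_eq hlu, (-u) ∘ base, ?_⟩
    rw [defectVector_of_weight_eq hA hlap hlu, zero_add]
  · rintro ⟨hloop, c, hc⟩
    refine ⟨-(potential l + c ∘ vertex), ?_, ?_⟩
    · rw [map_neg, map_add, laplacian_potential hA hsupp hns hpf hS hl, laplacian_comp_vertex hA,
        hc, ← Pi.add_comp, add_neg_cancel, Pi.zero_comp, neg_zero]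
    · funext t
      rw [weight_eq_potentialWeight hns hpf hS hl, hloop]
      simp [potentialWeight, t.vertex_eq]

/-- The class of a cocycle: its loop vector and its defect vector modulo the range of `1 - A_S`. -/
noncomputable def cocycleClass (hA : ∀ i j, 0 ≤ A i j) (hsupp : ∀ i j, A i j = 0 → B i j = 0)
    (hns : NoSinks A) (hpf : PseudoFree A B) (hS : IsOpen S) :
    cocycles 𝕜 (Restriction S) →ₗ[𝕜] LinearMap.ker (1 - verticesBlock 𝕜 S B).mulVecLin ×
      ((vertices S → 𝕜) ⧸ LinearMap.range (1 - verticesBlock 𝕜 S A).mulVecLin) :=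
  ((loopVector.domRestrict _).codRestrict _
    fun l => loopVector_mem_ker hA hsupp hns hpf hS l.2).prod
      (Submodule.mkQ _ ∘ₗ defectVector.domRestrict _)

theorem cocycleClass_surjective (hA : ∀ i j, 0 ≤ A i j) (hsupp : ∀ i j, A i j = 0 → B i j = 0)
    (hns : NoSinks A) (hpf : PseudoFree A B) (hS : IsOpen S) :
    Function.Surjective (cocycleClass (𝕜 := 𝕜) hA hsupp hns hpf hS) := by
  rintro ⟨⟨b, hb⟩, d⟩
  obtain ⟨d, rfl⟩ := Submodule.mkQ_surjective _ d
  obtain ⟨a, ha⟩ := exists_laplacian_eq hns d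
  obtain ⟨l, hl, hweight⟩ := exists_cocycle hA hsupp hns hpf hS hb ha
  refine ⟨⟨l, hl⟩, Prod.ext (Subtype.ext (loopVector_of_weight_eq hweight))
    ((Submodule.Quotient.eq _).2 ?_)⟩
  refine ⟨a ∘ base, ?_⟩
  exact eq_sub_of_add_eq' (defectVector_of_weight_eq hA ha hweight).symm

theorem cocycleClass_eq_zero_iff (hA : ∀ i j, 0 ≤ A i j) (hsupp : ∀ i j, A i j = 0 → B i j = 0)
    (hns : NoSinks A) (hpf : PseudoFree A B) (hS : IsOpen S)
    (l : cocycles 𝕜 (Restriction S)) :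
    cocycleClass hA hsupp hns hpf hS l = 0 ↔ l.1 ∈ coboundaries 𝕜 (Restriction S) := by
  rw [mem_coboundaries_iff_loopVector_defectVector hA hsupp hns hpf hS l.2,
    ← Submodule.Quotient.mk_eq_zero]
  exact Prod.ext_iff.trans (and_congr_left' Subtype.ext_iff)

theorem cocycleDim_restriction (hA : ∀ i j, 0 ≤ A i j) (hsupp : ∀ i j, A i j = 0 → B i j = 0)
    (hns : NoSinks A) (hpf : PseudoFree A B) (hS : IsOpen S) :
    cocycleDim 𝕜 (Restriction S) =
      Module.finrank 𝕜 (LinearMap.ker (1 - verticesBlock 𝕜 S B).mulVecLin) +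
        Module.finrank 𝕜 (LinearMap.ker (1 - verticesBlock 𝕜 S A).mulVecLin) := by
  rw [← finrank_quotient_range_eq_finrank_ker (1 - verticesBlock 𝕜 S A).mulVecLin,
    ← Module.finrank_prod]
  exact finrank_map_mkQ_of_surjective (cocycleClass hA hsupp hns hpf hS)
    (cocycleClass_surjective hA hsupp hns hpf hS) (cocycleClass_eq_zero_iff hA hsupp hns hpf hS)

end Cell

end CocycleDim

section FullSets

theorem exists_src_mem_vertices (hS : IsOpen S) (hfull : IsFull S) (x : InfPath A) :
    ∃ n, (x.1 n).src ∈ vertices S := by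
  obtain ⟨g, hsource, hrange⟩ := hfull (unitPt x)
  obtain ⟨q, rfl⟩ := Quot.exists_rep g
  obtain rfl : q.pt = x := KEP.unit_inj (congrArg Subtype.val hsource)
  obtain ⟨n, hn⟩ := exists_forall_length_inSet hS (x := q.im B) hrange
  set p := (Quad.step B)^[n] q with hp
  have hα : InSet S p.α := by
    refine hn _ ?_ (Quad.im_iterate_step n q ▸ p.im_mem_cylinder)
    rw [hp, (KEP.length_iterate n q).1]
    exact Nat.le_add_left n _
  have hsrc : (q.pt.1 (p.β.edges.length + 0)).src = p.α.tgt := by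
    rw [← Quad.pt_iterate_step (B := B) n q, ← hp, p.hα]
    exact congrArg Edge.src (prepend_apply_length_add p.β.edges p.y.1 0)
  exact ⟨_, ⟨p.α, hα⟩, hsrc.symm⟩

theorem exists_forall_src_mem_vertices (hS : IsOpen S) (hfull : IsFull S) :
    ∃ n, ∀ x : InfPath A, (x.1 n).src ∈ vertices S := by
  let U (n : ℕ) : Set (InfPath A) := {x | (x.1 n).src ∈ vertices S}
  have hmono : Monotone U := monotone_nat_of_le_succ fun n x hx =>
    show (x.1 (n + 1)).src ∈ vertices S from x.2 n ▸ tgt_mem_vertices hx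
  have hopen (n : ℕ) : IsOpen (U n) := InfPath.isOpen_iff.2 fun x hx =>
    ⟨n + 1, fun z hz => show (z.1 n).src ∈ vertices S from (hz n n.lt_succ_self).symm ▸ hx⟩
  obtain ⟨n, hn⟩ := isCompact_univ.elim_directed_cover U hopen
    (fun x _ => Set.mem_iUnion.2 (exists_src_mem_vertices hS hfull x)) hmono.directed_le
  exact ⟨n, fun x => hn (Set.mem_univ x)⟩

theorem exists_infPath_of_pow_ne_zero {R : Type*} [Semiring R] (hA : ∀ i j, 0 ≤ A i j)
    (hns : NoSinks A) {M : Matrix (Fin N) (Fin N) R} (hM : ∀ i j, A i j = 0 → M i j = 0) (n : ℕ)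
    {v w : Fin N} (h : (M ^ n) v w ≠ 0) : ∃ x : InfPath A, x.start = v ∧ (x.1 n).src = w := by
  induction n generalizing v with
  | zero =>
    obtain ⟨y, rfl⟩ := hns.exists_infPath v
    exact ⟨y, rfl, by_contra fun hne => h (by rw [pow_zero]; exact one_apply_ne hne)⟩
  | succ n ih =>
    rw [pow_succ', mul_apply] at h
    obtain ⟨u, -, hu⟩ := Finset.exists_ne_zero_of_sum_ne_zero h
    obtain ⟨x, rfl, hx⟩ := ih (right_ne_zero_of_mul hu)
    have hne : A v x.start ≠ 0 := fun h0 => left_ne_zero_of_mul hu (hM _ _ h0)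
    exact ⟨x.cons ⟨v, x.start, 0, le_rfl, (hA _ _).lt_of_ne hne.symm⟩ rfl, rfl, hx⟩

theorem finrank_ker_one_sub_verticesBlock (hA : ∀ i j, 0 ≤ A i j) (hns : NoSinks A)
    (hS : IsOpen S) (hfull : IsFull S) {M : Matrix (Fin N) (Fin N) ℤ}
    (hM : ∀ i j, A i j = 0 → M i j = 0) :
    Module.finrank 𝕜 (LinearMap.ker (1 - verticesBlock 𝕜 S M).mulVecLin) =
      Module.finrank 𝕜 (LinearMap.ker ((1 - M).map (algebraMap ℤ 𝕜)).mulVecLin) := by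
  obtain ⟨n, hn⟩ := exists_forall_src_mem_vertices hS hfull
  have hpow (v w : Fin N) (h : (M.map (Int.cast : ℤ → 𝕜) ^ n) v w ≠ 0) : w ∈ vertices S := by
    obtain ⟨x, -, rfl⟩ := exists_infPath_of_pow_ne_zero hA hns
      (fun i j h0 => by rw [map_apply, hM i j h0, Int.cast_zero]) n h
    exact hn x
  rw [Matrix.map_sub _ (_root_.map_sub _),
    Matrix.map_one _ (_root_.map_zero _) (_root_.map_one _)]
  exact finrank_ker_one_sub_toSquareBlockProp (mem_vertices_of_map_ne_zero hA hM) hpow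

end FullSets

end Katsura

open ArrowGroupoid Katsura in
theorem mainTheorem7_general {N N' : ℕ}
    {A B : Matrix (Fin N) (Fin N) ℤ} {A' B' : Matrix (Fin N') (Fin N') ℤ}
    (hA : ∀ i j, 0 ≤ A i j) (hA' : ∀ i j, 0 ≤ A' i j)
    (hrow : ∀ i, ∃ j, A i j ≠ 0) (hrow' : ∀ i, ∃ j, A' i j ≠ 0)
    (hsupp : ∀ i j, A i j = 0 → B i j = 0) (hsupp' : ∀ i j, A' i j = 0 → B' i j = 0)
    (hpf : PseudoFree A B) (hpf' : PseudoFree A' B')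
    {S : Set (UnitSpace (KEP A B))} {T : Set (UnitSpace (KEP A' B'))}
    (hS : IsOpen S) (hSfull : IsFull S) (hT : IsOpen T) (hTfull : IsFull T)
    (e : TopIso (Restriction S) (Restriction T)) :
    Nonempty (LinearMap.ker (1 - A).mulVecLin ≃+ LinearMap.ker (1 - A').mulVecLin) ∧
      Nonempty (LinearMap.ker (1 - B).mulVecLin ≃+ LinearMap.ker (1 - B').mulVecLin) := by
  have hns := noSinks_of_rows_ne_zero hA hrow
  have hns' := noSinks_of_rows_ne_zero hA' hrow'
  have hkerA := invariantDim_eq_of_topIso ℚ e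
  rw [Cell.invariantDim_restriction hA hns hpf hS,
    Cell.invariantDim_restriction hA' hns' hpf' hT] at hkerA
  have hkerB := cocycleDim_eq_of_topIso ℚ e
  rw [Cell.cocycleDim_restriction hA hsupp hns hpf hS,
    Cell.cocycleDim_restriction hA' hsupp' hns' hpf' hT, hkerA, Nat.add_right_cancel_iff,
    finrank_ker_one_sub_verticesBlock hA hns hS hSfull hsupp,
    finrank_ker_one_sub_verticesBlock hA' hns' hT hTfull hsupp'] at hkerB
  rw [finrank_ker_one_sub_verticesBlock hA hns hS hSfull fun _ _ h => h,
    finrank_ker_one_sub_verticesBlock hA' hns' hT hTfull fun _ _ h => h] at hkerA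
  exact ⟨(nonempty_ker_mulVecLin_linearEquiv ℚ hkerA).map LinearEquiv.toAddEquiv,
    (nonempty_ker_mulVecLin_linearEquiv ℚ hkerB).map LinearEquiv.toAddEquiv⟩

theorem mainTheorem7 {N N' : ℕ}
    (A B : Matrix (Fin N) (Fin N) ℤ) (A' B' : Matrix (Fin N') (Fin N') ℤ)
    (hA : ∀ i j, 0 ≤ A i j) (hA' : ∀ i j, 0 ≤ A' i j)
    (hrow : ∀ i, ∃ j, A i j ≠ 0) (hrow' : ∀ i, ∃ j, A' i j ≠ 0)
    (hsupp : ∀ i j, A i j = 0 → B i j = 0) (hsupp' : ∀ i j, A' i j = 0 → B' i j = 0)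
    (hpf : Katsura.PseudoFree A B) (hpf' : Katsura.PseudoFree A' B')
    (hK : ArrowGroupoid.KakutaniEquivalent (Katsura.KEP A B) (Katsura.KEP A' B')) :
    Nonempty (LinearMap.ker (1 - A).mulVecLin ≃+ LinearMap.ker (1 - A').mulVecLin) ∧
      Nonempty (LinearMap.ker (1 - B).mulVecLin ≃+ LinearMap.ker (1 - B').mulVecLin) := by
  obtain ⟨S, T, hS, hSfull, hT, hTfull, ⟨e⟩⟩ := hK
  exact mainTheorem7_general hA hA' hrow hrow' hsupp hsupp' hpf hpf' hS.isOpen hSfull hT.isOpen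
    hTfull e
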